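/- Let $\mathbf{qCat}_2$ be the strict 2-category whose objects are the quasi-categories, whose 1-cells (functors) are the maps of simplicial sets, and whose hom-category from $X$ to $Y$ is the homotopy category $h(Y^X)$ of the internal hom. For functors $f\colon B\to A$ and $g\colon C\to A$ of quasi-categories, let $f\downarrow g$ be the quasi-category obtained as the pullback of $(\mathrm{cod},\mathrm{dom})\colon A^{\Delta^1}\to A\times A$ along $g\times f\colon C\times B\to A\times A$; write $(q_1,q_0)\colon f\downarrow g\to C\times B$ for its projection and $\psi\colon f q_0\Rightarrow g q_1$ for the 2-cell represented by the map $f\downarrow g\to A^{\Delta^1}$ of the pullback square. For $\ell\colon C\to B$ write $B\downarrow\ell:=\mathrm{id}_B\downarrow\ell$, with projection $(p_1,p_0)\colon B\downarrow \ell\to C\times B$ and 2-cell $\phi\colon p_0\Rightarrow \ell p_1$. A 1-cell over $C\times B$ from $B\downarrow\ell$ to $f\downarrow g$ is a functor $w\colon B\downarrow\ell\to f\downarrow g$ with $(q_1,q_0)w=(p_1,p_0)$; two such 1-cells $w,w'$ are isomorphic over $C\times B$ if there is an invertible 2-cell $w\Rightarrow w'$ whose whiskered composite with $(q_1,q_0)$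 is the identity 2-cell of $(p_1,p_0)$. A 2-cell $\lambda\colon f\ell\Rightarrow g$ displays $\ell$ as an absolute right lifting of $g$ through $f$ if for all quasi-categories $X$, functors $b\colon X\to B$, $c\colon X\to C$ and 2-cells $\chi\colon fb\Rightarrow gc$ there is a unique 2-cell $\tau\colon b\Rightarrow \ell c$ with $\chi=\lambda c\cdot f\tau$. A 1-cell $w$ over $C\times B$ is induced by $\lambda$ if $\psi w=\lambda p_1\cdot f\phi$. Let $f\colon B\to A$, $g\colon C\to A$ and $\ell\colon C\to B$ be functors of quasi-categories. (i) Every 2-cell $\lambda\colon f\ell\Rightarrow g$ induces a 1-cell $w\colon B\downarrow\ell\to f\downarrow g$ over $C\times B$, and for every 1-cell $w$ induced by $\lambda$, the 2-cell $\lambda$ displays $\ell$ as an absolute right lifting of $g$ through $f$ if and only if $w$ is an equivalence in $\mathbf{qCat}_2$. (ii) Sending $\lambda$ to the 1-cells that it induces defines a bijection between the 2-cells $\lambda\colon f\ell\Rightarrow g$ and the isomorphism classes of 1-cells $w\colon B\downarrow\ell\to f\downarrow g$ over $C\times B$: there is a bijection under which the class of $w$ corresponds to $\lambda$ exactly when $w$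 is induced by $\lambda$. Furthermore, $\lambda$ displays $\ell$ as an absolute right lifting of $g$ through $f$ if and only if any representative $w$ of the corresponding isomorphism class is an equivalence. -/

import Mathlib

universe u v w

open CategoryTheory

namespace CommaQCat

section Slice

open Bicategory

variable {𝓑 : Type u} [Bicategory.{w, v} 𝓑]

/-- 1-cells over `Z` from `p : E ⟶ Z` to `q : F ⟶ Z`: 1-cells `E ⟶ F` which commute strictly
with the structure maps to `Z`. -/
structure SliceHom {E F Z : 𝓑} (p : E ⟶ Z) (q : F ⟶ Z) where
  /-- the underlying 1-cell -/
  hom : E ⟶ F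
  w : hom ≫ q = p

/-- 2-cells over `Z`: 2-cells whose whiskered composite with `q` is the identity 2-cell of `p`. -/
@[ext]
structure SliceCell {E F Z : 𝓑} {p : E ⟶ Z} {q : F ⟶ Z} (a b : SliceHom p q) where
  /-- the underlying 2-cell -/
  cell : a.hom ⟶ b.hom
  w : cell ▷ q = eqToHom (a.w.trans b.w.symm)

/-- The hom-category between two objects of the slice 2-category over `Z`. -/
instance {E F Z : 𝓑} (p : E ⟶ Z) (q : F ⟶ Z) : Category (SliceHom p q) where
  Hom a b := SliceCell a b
  id a := ⟨𝟙 a.hom, by simp⟩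
  comp s t := ⟨s.cell ≫ t.cell, by simp [s.w, t.w]⟩
  id_comp s := SliceCell.ext (Category.id_comp s.cell)
  comp_id s := SliceCell.ext (Category.comp_id s.cell)
  assoc s t r := SliceCell.ext (Category.assoc s.cell t.cell r.cell)

/-- Isomorphism classes of 1-cells over `Z`. -/
abbrev SliceHomClass {E F Z : 𝓑} (p : E ⟶ Z) (q : F ⟶ Z) :=
  Quotient (isIsomorphicSetoid (SliceHom p q))

/-- The isomorphism class of a 1-cell over `Z`. -/
abbrev SliceHom.isoClass {E F Z : 𝓑} {p : E ⟶ Z} {q : F ⟶ Z} (a : SliceHom p q) :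
    SliceHomClass p q :=
  Quotient.mk (isIsomorphicSetoid (SliceHom p q)) a

/-- A 1-cell is an equivalence if it underlies an equivalence. -/
def IsEquivalence {E F : 𝓑} (k : E ⟶ F) : Prop :=
  ∃ e : Bicategory.Equivalence E F, e.hom = k

/-- The triangle `lam : ℓ ≫ f ⟶ g` displays `ℓ` as an absolute right lifting of `g` through `f`. -/
def IsAbsoluteRightLifting {A B C : 𝓑} {f : B ⟶ A} {g : C ⟶ A} {ℓ : C ⟶ B}
    (lam : ℓ ≫ f ⟶ g) : Prop :=
  Nonempty (RightLift.mk ℓ lam).IsAbsKan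

lemma isEquivalence_iff {E F : 𝓑} (k : E ⟶ F) :
    IsEquivalence k ↔ ∃ l : F ⟶ E, Nonempty (𝟙 E ≅ k ≫ l) ∧ Nonempty (l ≫ k ≅ 𝟙 F) := by
  constructor
  · rintro ⟨e, rfl⟩
    exact ⟨e.inv, ⟨e.unit⟩, ⟨e.counit⟩⟩
  · rintro ⟨l, ⟨i⟩, ⟨j⟩⟩
    exact ⟨Equivalence.mkOfAdjointifyCounit i j, rfl⟩

lemma isAbsoluteRightLifting_iff {A B C : 𝓑} {f : B ⟶ A} {g : C ⟶ A} {ℓ : C ⟶ B}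
    (lam : ℓ ≫ f ⟶ g) :
    IsAbsoluteRightLifting lam ↔
      ∀ (X : 𝓑) (c : X ⟶ C) (b : X ⟶ B) (χ : b ≫ f ⟶ c ≫ g),
        ∃! τ : b ⟶ c ≫ ℓ, τ ▷ f ≫ (α_ c ℓ f).hom ≫ c ◁ lam = χ := by
  constructor
  · rintro ⟨H⟩ X c b χ
    refine ⟨(H c).desc (RightLift.mk b χ), (H c).fac (RightLift.mk b χ), fun τ hτ ↦ ?_⟩
    exact (H c).hom_ext (hτ.trans ((H c).fac (RightLift.mk b χ)).symm)
  · intro H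
    refine ⟨fun {X} c ↦ ?_⟩
    choose d hd hu using fun s : RightLift f (c ≫ g) ↦ H X c s.lift s.counit
    exact .mk (fun s ↦ RightLift.homMk (d s) (hd s))
      (fun s τ ↦ CostructuredArrow.hom_ext _ _ (hu s _ (RightLift.w τ)))

end Slice

noncomputable section

section Comma

open MonoidalCategory CartesianMonoidalCategory Simplicial

/-- Evaluation of the path object `A ^ Δ[1]` at the initial vertex of `Δ[1]`. -/
def pathSrc (A : SSet.{u}) : (ihom Δ[1]).obj A ⟶ A :=
  SSet.ι₀ ≫ (β_ _ _).hom ≫ (ihom.ev Δ[1]).app A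

/-- Evaluation of the path object `A ^ Δ[1]` at the final vertex of `Δ[1]`. -/
def pathTgt (A : SSet.{u}) : (ihom Δ[1]).obj A ⟶ A :=
  SSet.ι₁ ≫ (β_ _ _).hom ≫ (ihom.ev Δ[1]).app A

/-- The map `A ^ Δ[1] ⟶ A × A`, `α ↦ (codomain, domain)`. -/
def pathEnds (A : SSet.{u}) : (ihom Δ[1]).obj A ⟶ A ⊗ A :=
  lift (pathTgt A) (pathSrc A)

lemma comp_pathSrc {A V : SSet.{u}} (h : V ⟶ (ihom Δ[1]).obj A) :
    h ≫ pathSrc A = SSet.ι₀ ≫ (β_ _ _).hom ≫ MonoidalClosed.uncurry h := by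
  rw [MonoidalClosed.uncurry_eq, pathSrc, ← SSet.ι₀_comp_assoc]
  simp

lemma comp_pathTgt {A V : SSet.{u}} (h : V ⟶ (ihom Δ[1]).obj A) :
    h ≫ pathTgt A = SSet.ι₁ ≫ (β_ _ _).hom ≫ MonoidalClosed.uncurry h := by
  rw [MonoidalClosed.uncurry_eq, pathTgt, ← SSet.ι₁_comp_assoc]
  simp

/-- The discrete simplicial set on two vertices. -/
def twoPoints : SSet.{u} := (Functor.const _).obj (ULift.{u} Bool)

/-- The inclusion of the two vertices of `Δ[1]`. -/
def twoPointsι : twoPoints.{u} ⟶ Δ[1] where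
  app n := ↾fun s ↦ (SSet.const (SSet.stdSimplex.obj₀Equiv.symm (bif s.down then 1 else 0)) :
      (𝟙_ SSet.{u}) ⟶ Δ[1]).app n PUnit.unit
  naturality n m f := by
    ext s
    rfl

instance : Mono twoPointsι.{u} := by
  rw [NatTrans.mono_iff_mono_app]
  intro n
  rw [mono_iff_injective]
  rintro ⟨s⟩ ⟨t⟩ h
  have h' := congrArg (fun z : (Δ[1] : SSet.{u}).obj n ↦ SSet.stdSimplex.objEquiv z 0) h
  change (bif s then (1 : Fin 2) else 0) = (bif t then (1 : Fin 2) else 0) at h'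
  cases s <;> cases t <;> first | rfl | simp at h'

/-- The inclusion of `V` as one of the two copies of `V` in the product with `twoPoints`. -/
def twoPointsIn (s : Bool) (V : SSet.{u}) : V ⟶ twoPoints ⊗ V where
  app _ := ↾fun x ↦ (ULift.up s, x)
  naturality _ _ _ := rfl

/-- Gluing of a pair of maps into a map out of the product with the two point simplicial set. -/
def glue {V A : SSet.{u}} (a₀ a₁ : V ⟶ A) : twoPoints ⊗ V ⟶ A where
  app n := ↾fun x ↦ bif x.1.down then a₁.app n x.2 else a₀.app n x.2
  naturality n m f := by
    ext ⟨⟨s⟩, x⟩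
    cases s
    · exact NatTrans.naturality_apply a₀ f x
    · exact NatTrans.naturality_apply a₁ f x

lemma twoPoints_hom_ext {V A : SSet.{u}} {k l : twoPoints ⊗ V ⟶ A}
    (h : ∀ s, twoPointsIn s V ≫ k = twoPointsIn s V ≫ l) : k = l := by
  ext n ⟨⟨s⟩, x⟩
  exact ConcreteCategory.congr_hom (NatTrans.congr_app (h s) n) x

lemma comp_pathSrc' {A V : SSet.{u}} (h : V ⟶ (ihom Δ[1]).obj A) :
    h ≫ pathSrc A =
      twoPointsIn false V ≫ MonoidalClosed.uncurry (h ≫ (MonoidalClosed.pre twoPointsι).app A) := by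
  rw [MonoidalClosed.uncurry_pre_app, comp_pathSrc]
  rfl

lemma comp_pathTgt' {A V : SSet.{u}} (h : V ⟶ (ihom Δ[1]).obj A) :
    h ≫ pathTgt A =
      twoPointsIn true V ≫ MonoidalClosed.uncurry (h ≫ (MonoidalClosed.pre twoPointsι).app A) := by
  rw [MonoidalClosed.uncurry_pre_app, comp_pathTgt]
  rfl

instance (A : SSet.{u}) [SSet.Quasicategory A] : SSet.InnerFibration (pathEnds A) := by
  rw [SSet.innerFibration_iff]
  intro U V j hj
  refine ⟨fun {a b} sq ↦ ?_⟩
  have := SSet.mem_innerFibrations ((MonoidalClosed.pre twoPointsι).app A) j hj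
  have w₁ : a ≫ pathTgt A = j ≫ b ≫ fst _ _ := by
    have := sq.w =≫ fst _ _
    simpa [pathEnds] using this
  have w₀ : a ≫ pathSrc A = j ≫ b ≫ snd _ _ := by
    have := sq.w =≫ snd _ _
    simpa [pathEnds] using this
  have sq' : CommSq a j ((MonoidalClosed.pre twoPointsι).app A)
      (MonoidalClosed.curry (glue (b ≫ snd _ _) (b ≫ fst _ _))) := ⟨by
    apply MonoidalClosed.uncurry_injective
    apply twoPoints_hom_ext
    rintro (_ | _)
    · rw [← comp_pathSrc', w₀, MonoidalClosed.uncurry_natural_left, MonoidalClosed.uncurry_curry]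
      rfl
    · rw [← comp_pathTgt', w₁, MonoidalClosed.uncurry_natural_left, MonoidalClosed.uncurry_curry]
      rfl⟩
  refine ⟨⟨⟨sq'.lift, sq'.fac_left, ?_⟩⟩⟩
  apply CartesianMonoidalCategory.hom_ext
  · rw [pathEnds, Category.assoc, lift_fst, comp_pathTgt', sq'.fac_right,
      MonoidalClosed.uncurry_curry]
    rfl
  · rw [pathEnds, Category.assoc, lift_snd, comp_pathSrc', sq'.fac_right,
      MonoidalClosed.uncurry_curry]
    rfl

lemma quasicategory_tensor (X Y : SSet.{u}) [SSet.Quasicategory X] [hY : SSet.Quasicategory Y] :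
    SSet.Quasicategory (X ⊗ Y) := by
  have h : IsPullback (fst X Y) (snd X Y) (Limits.terminal.from X) (Limits.terminal.from Y) :=
    .of_is_product' (tensorProductIsBinaryProduct X Y) Limits.terminalIsTerminal
  have : SSet.InnerFibration (fst X Y) := by
    rw [SSet.innerFibration_iff]
    exact SSet.innerFibrations.of_isPullback h.flip
      (SSet.mem_innerFibrations (Limits.terminal.from Y))
  exact SSet.quasicategory_of_innerFibration (fst X Y)

/-- The comma construction `f ↓ g` for maps `f : B ⟶ A` and `g : C ⟶ A` of simplicial sets: the
pullback of `(codomain, domain) : A ^ Δ[1] ⟶ A × A` along `g × f : C × B ⟶ A × A`. -/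
def commaSSet {A B C : SSet.{u}} (f : B ⟶ A) (g : C ⟶ A) : SSet.{u} :=
  Limits.pullback (g ⊗ₘ f) (pathEnds A)

lemma quasicategory_commaSSet {A B C : SSet.{u}} [SSet.Quasicategory A] [SSet.Quasicategory B]
    [SSet.Quasicategory C] (f : B ⟶ A) (g : C ⟶ A) : SSet.Quasicategory (commaSSet f g) := by
  have : SSet.InnerFibration (Limits.pullback.fst (g ⊗ₘ f) (pathEnds A)) := by
    rw [SSet.innerFibration_iff]
    exact SSet.innerFibrations.of_isPullback (IsPullback.of_hasPullback _ _).flip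
      (SSet.mem_innerFibrations (pathEnds A))
  have := quasicategory_tensor C B
  change SSet.Quasicategory (Limits.pullback (g ⊗ₘ f) (pathEnds A))
  exact SSet.quasicategory_of_innerFibration (Limits.pullback.fst (g ⊗ₘ f) (pathEnds A))

/-- The strict 2-category of quasi-categories: 1-cells are maps of simplicial sets and the
category of 1-cells from `X` to `Y` is the homotopy category of `Y ^ X`. This is a synonym of
`SSet.QCat` which only carries the 2-categorical structure. -/
def QCat₂ : Type (u + 1) := SSet.QCat.{u}

instance : Bicategory QCat₂.{u} := SSet.QCat.bicategory.{u}

namespace QCat₂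

lemma strict : Bicategory.Strict QCat₂.{u} := SSet.QCat.strictBicategory.{u}

/-- The underlying simplicial set of a quasi-category. -/
def sSet (X : QCat₂.{u}) : SSet.{u} := ObjectProperty.FullSubcategory.obj X

instance (X : QCat₂.{u}) : SSet.Quasicategory X.sSet := ObjectProperty.FullSubcategory.property X

/-- A simplicial set which is a quasi-category, as an object of the 2-category. -/
def of (X : SSet.{u}) (hX : SSet.Quasicategory X) : QCat₂.{u} := ⟨X, hX⟩

/-- The map of simplicial sets underlying a 1-cell. -/
def map {X Y : QCat₂.{u}} (h : X ⟶ Y) : X.sSet ⟶ Y.sSet :=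
  (ObjectProperty.ι SSet.Quasicategory).map h

/-- The 1-cell given by a map of simplicial sets. -/
def ofMap {X Y : QCat₂.{u}} (h : X.sSet ⟶ Y.sSet) : X ⟶ Y := ObjectProperty.homMk h

/-- The 1-simplex of the simplicial set `Y ^ X` of maps given by `H : X × Δ[1] ⟶ Y`. -/
def edgeOfHomotopy {X Y : SSet.{u}} {h k : X ⟶ Y} (H : X ⊗ Δ[1] ⟶ Y)
    (h₀ : SSet.ι₀ ≫ H = h) (h₁ : SSet.ι₁ ≫ H = k) :
    SSet.Edge (X := X.functorHom Y) (Functor.HomObj.ofNatTrans h) (Functor.HomObj.ofNatTrans k) :=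
  SSet.Edge.mk (SSet.yonedaEquiv ((FunctorToTypes.functorHomEquiv X Δ[1] Y).symm H))
    (by
      subst h₀
      refine Functor.functorHom_ext fun n φ ↦ ?_
      ext x
      apply congrArg (fun t ↦ H.app n (x, t))
      apply SSet.stdSimplex.objEquiv.injective
      ext k : 3
      change (SimplexCategory.δ 1).toOrderHom (φ.unop.toOrderHom k) = (0 : Fin 2)
      rw [show φ.unop.toOrderHom k = (0 : Fin 1) from Subsingleton.elim (α := Fin 1) _ _]
      rfl)
    (by
      subst h₁
      refine Functor.functorHom_ext fun n φ ↦ ?_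
      ext x
      apply congrArg (fun t ↦ H.app n (x, t))
      apply SSet.stdSimplex.objEquiv.injective
      ext k : 3
      change (SimplexCategory.δ 0).toOrderHom (φ.unop.toOrderHom k) = (1 : Fin 2)
      rw [show φ.unop.toOrderHom k = (0 : Fin 1) from Subsingleton.elim (α := Fin 1) _ _]
      rfl)

/-- The 2-cell `h ⟶ k` represented by `H : X × Δ[1] ⟶ Y` with `H(-,0) = h` and `H(-,1) = k`. -/
def cellOfHomotopy {X Y : QCat₂.{u}} {h k : X ⟶ Y} (H : X.sSet ⊗ Δ[1] ⟶ Y.sSet)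
    (h₀ : SSet.ι₀ ≫ H = map h) (h₁ : SSet.ι₁ ≫ H = map k) : h ⟶ k :=
  CatEnrichedOrdinary.Hom.mk
    (SSet.Truncated.HomotopyCategory.homMk (edgeOfHomotopy H h₀ h₁).toTruncated)

/-- The product of two quasi-categories. -/
def prod (C B : QCat₂.{u}) : QCat₂.{u} :=
  of (C.sSet ⊗ B.sSet) (quasicategory_tensor C.sSet B.sSet)

/-- The first projection. -/
def prodFst (C B : QCat₂.{u}) : prod C B ⟶ C := ofMap (fst C.sSet B.sSet)

/-- The second projection. -/
def prodSnd (C B : QCat₂.{u}) : prod C B ⟶ B := ofMap (snd C.sSet B.sSet)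

variable {A B C : QCat₂.{u}} (f : B ⟶ A) (g : C ⟶ A)

/-- The comma quasi-category `f ↓ g`. -/
def comma : QCat₂.{u} :=
  of (commaSSet (map f) (map g)) (quasicategory_commaSSet (map f) (map g))

/-- The projection `(p₁, p₀) : f ↓ g ⟶ C × B`. -/
def commaProj : comma f g ⟶ prod C B :=
  ofMap (Limits.pullback.fst (map g ⊗ₘ map f) (pathEnds A.sSet))

/-- The codomain projection `p₁ : f ↓ g ⟶ C`. -/
def commaTgt : comma f g ⟶ C := commaProj f g ≫ prodFst C B

/-- The domain projection `p₀ : f ↓ g ⟶ B`. -/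
def commaSrc : comma f g ⟶ B := commaProj f g ≫ prodSnd C B

/-- The map `f ↓ g ⟶ A ^ Δ[1]` from the defining pullback square, transposed. -/
def commaHomotopy : (comma f g).sSet ⊗ Δ[1] ⟶ A.sSet :=
  (β_ _ _).hom ≫
    MonoidalClosed.uncurry (Limits.pullback.snd (map g ⊗ₘ map f) (pathEnds A.sSet))

/-- The canonical comma cone `f p₀ ⟶ g p₁`. -/
def commaCell : commaSrc f g ≫ f ⟶ commaTgt f g ≫ g :=
  cellOfHomotopy (commaHomotopy f g)
    (by
      have := Limits.pullback.condition (f := map g ⊗ₘ map f) (g := pathEnds A.sSet) =≫ snd _ _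
      refine (comp_pathSrc _).symm.trans ?_
      simp [pathEnds] at this
      exact this.symm)
    (by
      have := Limits.pullback.condition (f := map g ⊗ₘ map f) (g := pathEnds A.sSet) =≫ fst _ _
      refine (comp_pathTgt _).symm.trans ?_
      simp [pathEnds] at this
      exact this.symm)

end QCat₂

end Comma

namespace QCat₂

open Bicategory

variable {A B C : QCat₂.{u}} {f : B ⟶ A} {g : C ⟶ A} {X : QCat₂.{u}}

lemma commaSrc_comp {p : X ⟶ prod C B} (a : SliceHom p (commaProj f g)) :
    a.hom ≫ commaSrc f g ≫ f = (p ≫ prodSnd C B) ≫ f := by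
  have := strict.{u}
  have h : a.hom ≫ commaSrc f g = p ≫ prodSnd C B :=
    (Strict.assoc _ _ _).symm.trans (congrArg (· ≫ prodSnd C B) a.w)
  rw [← h, Strict.assoc]

lemma commaTgt_comp {p : X ⟶ prod C B} (a : SliceHom p (commaProj f g)) :
    (p ≫ prodFst C B) ≫ g = a.hom ≫ commaTgt f g ≫ g := by
  have := strict.{u}
  have h : a.hom ≫ commaTgt f g = p ≫ prodFst C B :=
    (Strict.assoc _ _ _).symm.trans (congrArg (· ≫ prodFst C B) a.w)
  rw [← h, Strict.assoc]

/-- The whiskered composite of the canonical comma cone of `f ↓ g` with a 1-cell `X ⟶ f ↓ g`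
over `C × B`. -/
def restrictCell {p : X ⟶ prod C B} (a : SliceHom p (commaProj f g)) :
    (p ≫ prodSnd C B) ≫ f ⟶ (p ≫ prodFst C B) ≫ g :=
  eqToHom (commaSrc_comp a).symm ≫ a.hom ◁ commaCell f g ≫ eqToHom (commaTgt_comp a).symm

/-- The pasted composite of a triangle `lam : ℓ ≫ f ⟶ g` with the canonical comma cone of
`B ↓ ℓ`. -/
def pasteCell {ℓ : C ⟶ B} (lam : ℓ ≫ f ⟶ g) :
    commaSrc (𝟙 B) ℓ ≫ f ⟶ commaTgt (𝟙 B) ℓ ≫ g :=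
  (ρ_ (commaSrc (𝟙 B) ℓ)).inv ▷ f ≫ commaCell (𝟙 B) ℓ ▷ f ≫
    (α_ (commaTgt (𝟙 B) ℓ) ℓ f).hom ≫ commaTgt (𝟙 B) ℓ ◁ lam

/-- The 1-cell `a : B ↓ ℓ ⟶ f ↓ g` over `C × B` is induced by the triangle `lam`: the comma cone
of `f ↓ g` whiskered with `a` is the comma cone of `B ↓ ℓ` pasted with `lam`. -/
def IsInducedBy {ℓ : C ⟶ B} (lam : ℓ ≫ f ⟶ g)
    (a : SliceHom (commaProj (𝟙 B) ℓ) (commaProj f g)) : Prop :=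
  pasteCell lam = restrictCell a

end QCat₂

end

end CommaQCat

namespace CommaQCat

/-! ### The homotopy category of a quasi-category: edges and 2-simplices. -/

section HomotopyCategory

open Simplicial SSet SimplicialObject.Truncated

/-! The comma `f ↓ g` is a strict pullback of simplicial sets, but in the 2-category it has only a
weak universal property, `IsWeakComma`. Every 2-cell `fb ⇒ gc` is classified by a 1-cell into `f ↓
g`; a compatible pair of 2-cells on the two projections lifts to a 2-cell, not necessarily uniquely;
and a 2-cell is invertible once both of its projections are. Given this, the theorem is formal, and
that part is carried out in an arbitrary bicategory.

Bijection. The comma `B ↓ ℓ` classifies 2-cells `b ⇒ ℓc`, so the identity of `ℓ` gives a 1-cell `i`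
from `C` to `B ↓ ℓ`, and 2-cell induction gives a 2-cell from the identity to `p₁ ≫ i` with
components `φ` and an identity. By a Yoneda argument, restriction along `i` is inverse to pasting
with `φ`, so the `λ` correspond to all 2-cells `f p₀ ⇒ g p₁` on `B ↓ ℓ` (`pasteCell_bijective`). The
1-cells over `C × B`, up to isomorphism, correspond to the same 2-cells (`sliceHomClassEquiv`).

Equivalences. If `w` is induced by `λ` and `t` classifies `τ`, then `t ≫ w` classifies `λc · fτ`.
Thus `w` is an equivalence exactly when pasting with `λ` is bijective: an inverse of `w` produces
liftings and its fullness gives their uniqueness, while conversely the lifting of the universal cell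
`ψ` is classified by an inverse of `w`.

The simplicial work is `isWeakComma_commaCell`. A 2-cell is the class of a homotopy, and an equation
between a composite and a 2-cell is a 2-simplex. Classification is the strict pullback property. For
2-cell induction, a commuting square in the homotopy category is cut along its diagonal into two
2-simplices, each giving one edge of the comma. For conservativity, every edge is factored into two
edges of these kinds, and each is inverted by filling inner horns of dimension 3. -/

lemma Quasicategory.exists_two_simplex {M : SSet.{u}} [Quasicategory M] (a b : M _⦋1⦌)
    (h : M.δ 0 a = M.δ 1 b) : ∃ s : M _⦋2⦌, M.δ 2 s = a ∧ M.δ 0 s = b := by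
  obtain ⟨s, hs⟩ := Quasicategory.hornFilling (i := (1 : Fin 3)) (by simp) (by decide)
    (horn₂₁.isPushout.desc (yonedaEquiv.symm a) (yonedaEquiv.symm b) (by
      rw [stdSimplex.δ_comp_yonedaEquiv_symm, stdSimplex.δ_comp_yonedaEquiv_symm, h]))
  obtain ⟨s, rfl⟩ := yonedaEquiv.symm.surjective s
  refine ⟨s, yonedaEquiv.symm.injective ?_, yonedaEquiv.symm.injective ?_⟩
  · rw [← stdSimplex.δ_comp_yonedaEquiv_symm, ← horn.ι_ι 1 2 (by simp), Category.assoc, ← hs]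
    exact horn₂₁.isPushout.inl_desc _ _ _
  · rw [← stdSimplex.δ_comp_yonedaEquiv_symm, ← horn.ι_ι 1 0 (by simp), Category.assoc, ← hs]
    exact horn₂₁.isPushout.inr_desc _ _ _

lemma Quasicategory.exists_three_simplex₁ {M : SSet.{u}} [Quasicategory M] (s₀ s₂ s₃ : M _⦋2⦌)
    (h₁₂ : M.δ 2 s₀ = M.δ 0 s₃) (h₁₃ : M.δ 1 s₀ = M.δ 0 s₂) (h₂₃ : M.δ 2 s₂ = M.δ 2 s₃) :
    ∃ t : M _⦋3⦌, M.δ 0 t = s₀ ∧ M.δ 2 t = s₂ ∧ M.δ 3 t = s₃ := by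
  obtain ⟨t, ht⟩ := Quasicategory.hornFilling (i := (1 : Fin 4)) (by simp) (by decide)
    (horn₃₁.desc (yonedaEquiv.symm s₀) (yonedaEquiv.symm s₂) (yonedaEquiv.symm s₃)
      (by simp only [stdSimplex.δ_comp_yonedaEquiv_symm, h₁₂])
      (by simp only [stdSimplex.δ_comp_yonedaEquiv_symm, h₁₃])
      (by simp only [stdSimplex.δ_comp_yonedaEquiv_symm, h₂₃]))
  obtain ⟨t, rfl⟩ := yonedaEquiv.symm.surjective t
  refine ⟨t, yonedaEquiv.symm.injective ?_, yonedaEquiv.symm.injective ?_,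
    yonedaEquiv.symm.injective ?_⟩
  · rw [← stdSimplex.δ_comp_yonedaEquiv_symm, ← horn.ι_ι 1 0 (by simp), Category.assoc, ← ht]
    exact horn₃₁.ι₀_desc _ _ _ _ _ _
  · rw [← stdSimplex.δ_comp_yonedaEquiv_symm, ← horn.ι_ι 1 2 (by simp), Category.assoc, ← ht]
    exact horn₃₁.ι₂_desc _ _ _ _ _ _
  · rw [← stdSimplex.δ_comp_yonedaEquiv_symm, ← horn.ι_ι 1 3 (by simp), Category.assoc, ← ht]
    exact horn₃₁.ι₃_desc _ _ _ _ _ _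

lemma Quasicategory.exists_three_simplex₂ {M : SSet.{u}} [Quasicategory M] (s₀ s₁ s₃ : M _⦋2⦌)
    (h₀₂ : M.δ 2 s₁ = M.δ 1 s₃) (h₁₂ : M.δ 2 s₀ = M.δ 0 s₃) (h₂₃ : M.δ 0 s₀ = M.δ 0 s₁) :
    ∃ t : M _⦋3⦌, M.δ 0 t = s₀ ∧ M.δ 1 t = s₁ ∧ M.δ 3 t = s₃ := by
  obtain ⟨t, ht⟩ := Quasicategory.hornFilling (i := (2 : Fin 4)) (by simp) (by decide)
    (horn₃₂.desc (yonedaEquiv.symm s₀) (yonedaEquiv.symm s₁) (yonedaEquiv.symm s₃)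
      (by simp only [stdSimplex.δ_comp_yonedaEquiv_symm, h₀₂])
      (by simp only [stdSimplex.δ_comp_yonedaEquiv_symm, h₁₂])
      (by simp only [stdSimplex.δ_comp_yonedaEquiv_symm, h₂₃]))
  obtain ⟨t, rfl⟩ := yonedaEquiv.symm.surjective t
  refine ⟨t, yonedaEquiv.symm.injective ?_, yonedaEquiv.symm.injective ?_,
    yonedaEquiv.symm.injective ?_⟩
  · rw [← stdSimplex.δ_comp_yonedaEquiv_symm, ← horn.ι_ι 2 0 (by simp), Category.assoc, ← ht]
    exact horn₃₂.ι₀_desc _ _ _ _ _ _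
  · rw [← stdSimplex.δ_comp_yonedaEquiv_symm, ← horn.ι_ι 2 1 (by simp), Category.assoc, ← ht]
    exact horn₃₂.ι₁_desc _ _ _ _ _ _
  · rw [← stdSimplex.δ_comp_yonedaEquiv_symm, ← horn.ι_ι 2 3 (by simp), Category.assoc, ← ht]
    exact horn₃₂.ι₃_desc _ _ _ _ _ _

/-- The `2`-truncation of a quasi-category is a `2`-truncated quasi-category. -/
instance {M : SSet.{u}} [Quasicategory M] : Truncated.Quasicategory₂ ((truncation 2).obj M) where
  fill21 {x₀ x₁ x₂} e₀₁ e₁₂ := by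
    obtain ⟨s, h₂, h₀⟩ := Quasicategory.exists_two_simplex (M := M) e₀₁.edge e₁₂.edge
      (e₀₁.tgt_eq.trans e₁₂.src_eq.symm)
    refine ⟨⟨⟨M.δ 1 s, ?_, ?_⟩, ⟨s, h₂, h₀, rfl⟩⟩⟩
    · refine Eq.trans ?_ e₀₁.src_eq
      rw [← h₂]
      exact (δ_comp_δ_apply (S := M) (i := 1) (j := 1) le_rfl s).symm
    · refine Eq.trans ?_ e₁₂.tgt_eq
      rw [← h₀]
      exact δ_comp_δ_apply (S := M) (i := 0) (j := 0) le_rfl s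
  fill31 f₃ f₀ f₂ := by
    obtain ⟨t, h₀, h₂, h₃⟩ := Quasicategory.exists_three_simplex₁ (M := M)
      f₀.simplex f₂.simplex f₃.simplex (f₀.d₂.trans f₃.d₀.symm) (f₀.d₁.trans f₂.d₀.symm)
      (f₂.d₂.trans f₃.d₂.symm)
    refine ⟨⟨M.δ 1 t, Eq.trans ?_ f₃.d₁, Eq.trans ?_ f₀.d₀, Eq.trans ?_ f₂.d₁⟩⟩
    · rw [← h₃]
      exact (δ_comp_δ_apply (S := M) (i := 1) (j := 2) (by decide) t).symm
    · rw [← h₀]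
      exact δ_comp_δ_apply (S := M) (i := 0) (j := 0) le_rfl t
    · rw [← h₂]
      exact (δ_comp_δ_apply (S := M) (i := 1) (j := 1) le_rfl t).symm
  fill32 f₃ f₀ f₁ := by
    obtain ⟨t, h₀, h₁, h₃⟩ := Quasicategory.exists_three_simplex₂ (M := M)
      f₀.simplex f₁.simplex f₃.simplex (f₁.d₂.trans f₃.d₁.symm) (f₀.d₂.trans f₃.d₀.symm)
      (f₀.d₀.trans f₁.d₀.symm)
    refine ⟨⟨M.δ 2 t, Eq.trans ?_ f₃.d₂, Eq.trans ?_ f₀.d₁, Eq.trans ?_ f₁.d₁⟩⟩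
    · rw [← h₃]
      exact (δ_comp_δ_apply (S := M) (i := 2) (j := 2) le_rfl t).symm
    · rw [← h₀]
      exact δ_comp_δ_apply (S := M) (i := 0) (j := 1) (by decide) t
    · rw [← h₁]
      exact δ_comp_δ_apply (S := M) (i := 1) (j := 1) le_rfl t

open Truncated HomotopyCategory in
-- The classes of edges generate the homotopy category, and filling an inner 2-horn shows that they
-- are closed under composition; hence every morphism is a single edge.
lemma exists_homMk_eq {V : Truncated.{u} 2} [Truncated.Quasicategory₂ V] {x y : V _⦋0⦌₂}
    (k : HomotopyCategory.mk x ⟶ HomotopyCategory.mk y) :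
    ∃ e : Truncated.Edge x y, HomotopyCategory.homMk e = k := by
  let W : MorphismProperty V.HomotopyCategory := fun a b t ↦
    ∃ e : Truncated.Edge a.as.as b.as.as, HomotopyCategory.homMk e = t
  have : W.IsMultiplicative :=
    { id_mem a := ⟨.id _, HomotopyCategory.homMk_id a.as.as⟩
      comp_mem := by
        rintro a b c _ _ ⟨e, rfl⟩ ⟨e', rfl⟩
        obtain ⟨⟨e'', h⟩⟩ := Quasicategory₂.fill21 e e'
        exact ⟨e'', (HomotopyCategory.homMk_comp_homMk h).symm⟩ }
  have hW : W = ⊤ := HomotopyCategory.morphismProperty_eq_top fun e ↦ ⟨e, rfl⟩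
  have : W k := by rw [hW]; trivial
  exact this

/-- The comparison functor from the homotopy category of a `2`-truncated quasi-category, defined
by generators and relations, to the category of homotopy classes of edges. -/
noncomputable def toHomotopyCategory₂ (V : Truncated.{u} 2) [Truncated.Quasicategory₂ V] :
    V.HomotopyCategory ⥤ V.HomotopyCategory₂ :=
  Truncated.HomotopyCategory.lift (fun x ↦ ⟨x⟩) (fun e ↦ Truncated.HomotopyCategory₂.homMk e)
    (fun _ ↦ rfl) (fun h ↦ h.homotopyCategory₂_fac)

lemma toHomotopyCategory₂_map_homMk {V : Truncated.{u} 2} [Truncated.Quasicategory₂ V]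
    {x y : V _⦋0⦌₂} (e : Truncated.Edge x y) :
    (toHomotopyCategory₂ V).map (Truncated.HomotopyCategory.homMk e) =
      Truncated.HomotopyCategory₂.homMk e :=
  Truncated.HomotopyCategory.lift_map_homMk _ _ _ _ e

/-- An equation in the category presented by generators and relations is hard to analyse directly.
It is transported to the category of homotopy classes of edges, where it amounts to the existence of
a 2-simplex. -/
lemma nonempty_compStruct_iff {V : Truncated.{u} 2} [Truncated.Quasicategory₂ V]
    {x₀ x₁ x₂ : V _⦋0⦌₂} (e₀₁ : Truncated.Edge x₀ x₁) (e₁₂ : Truncated.Edge x₁ x₂)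
    (e₀₂ : Truncated.Edge x₀ x₂) :
    Nonempty (Truncated.Edge.CompStruct e₀₁ e₁₂ e₀₂) ↔
      Truncated.HomotopyCategory.homMk e₀₁ ≫ Truncated.HomotopyCategory.homMk e₁₂ =
        Truncated.HomotopyCategory.homMk e₀₂ := by
  refine ⟨fun ⟨h⟩ ↦ Truncated.HomotopyCategory.homMk_comp_homMk h, fun h ↦ ?_⟩
  rw [Truncated.Edge.CompStruct.nonempty_iff]
  have := congrArg (toHomotopyCategory₂ V).map h
  rw [Functor.map_comp] at this
  rw [toHomotopyCategory₂_map_homMk, toHomotopyCategory₂_map_homMk,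
    toHomotopyCategory₂_map_homMk] at this
  exact this

end HomotopyCategory

/-! ### 2-cells of quasi-categories as homotopies. -/

noncomputable section

open MonoidalCategory CartesianMonoidalCategory Simplicial

section Cylinder

variable {X Y Z : SSet.{u}}

instance [SSet.Quasicategory Y] : SSet.Quasicategory (X.functorHom Y) :=
  inferInstanceAs (SSet.Quasicategory ((ihom X).obj Y))

/-- The `n`-simplices of the simplicial set of maps `Y ^ X` are the maps `X × Δ[n] ⟶ Y`. -/
def cylinderEquiv (n : ℕ) : (X ⊗ Δ[n] ⟶ Y) ≃ (X.functorHom Y : SSet.{u}) _⦋n⦌ :=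
  (FunctorToTypes.functorHomEquiv X Δ[n] Y).symm.trans SSet.yonedaEquiv

lemma cylinderEquiv_δ {n : ℕ} (i : Fin (n + 2)) (H : X ⊗ Δ[n + 1] ⟶ Y) :
    SimplicialObject.δ (X := (X.functorHom Y : SSet.{u})) i (cylinderEquiv (n + 1) H) =
      cylinderEquiv n (X ◁ SSet.stdSimplex.δ i ≫ H) :=
  rfl

lemma cylinderEquiv_zero (k : X ⟶ Y) :
    cylinderEquiv 0 (fst X Δ[0] ≫ k) = Functor.HomObj.ofNatTrans k := by
  rfl

lemma ι₀_eq : (SSet.ι₀ : X ⟶ X ⊗ Δ[1]) =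
    lift (𝟙 X) (SSet.const (SSet.stdSimplex.obj₀Equiv.symm 0)) ≫ X ◁ SSet.stdSimplex.δ 1 := by
  rw [SSet.stdSimplex.δ_one_eq_const, lift_whiskerLeft]
  rfl

lemma ι₁_eq : (SSet.ι₁ : X ⟶ X ⊗ Δ[1]) =
    lift (𝟙 X) (SSet.const (SSet.stdSimplex.obj₀Equiv.symm 0)) ≫ X ◁ SSet.stdSimplex.δ 0 := by
  rw [SSet.stdSimplex.δ_zero_eq_const, lift_whiskerLeft]
  rfl

end Cylinder

namespace QCat₂

open Bicategory

variable {X Y Z : QCat₂.{u}}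

lemma exists_cellOfHomotopy {h k : X ⟶ Y} (η : h ⟶ k) :
    ∃ (H : X.sSet ⊗ Δ[1] ⟶ Y.sSet) (h₀ : SSet.ι₀ ≫ H = map h) (h₁ : SSet.ι₁ ≫ H = map k),
      cellOfHomotopy H h₀ h₁ = η := by
  obtain ⟨e, he⟩ := exists_homMk_eq (V := (SSet.truncation 2).obj (X.sSet.functorHom Y.sSet))
    (x := Functor.HomObj.ofNatTrans (map h)) (y := Functor.HomObj.ofNatTrans (map k))
    (CatEnrichedOrdinary.Hom.base η)
  obtain ⟨H, hH⟩ := (cylinderEquiv 1).surjective e.edge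
  have h₀ : SSet.ι₀ ≫ H = map h := by
    have : X.sSet ◁ SSet.stdSimplex.δ 1 ≫ H = fst X.sSet Δ[0] ≫ map h := by
      apply (cylinderEquiv 0).injective
      rw [← cylinderEquiv_δ, hH, cylinderEquiv_zero]
      exact e.src_eq
    rw [ι₀_eq, Category.assoc, this, lift_fst_assoc, Category.id_comp]
  have h₁ : SSet.ι₁ ≫ H = map k := by
    have : X.sSet ◁ SSet.stdSimplex.δ 0 ≫ H = fst X.sSet Δ[0] ≫ map k := by
      apply (cylinderEquiv 0).injective
      rw [← cylinderEquiv_δ, hH, cylinderEquiv_zero]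
      exact e.tgt_eq
    rw [ι₁_eq, Category.assoc, this, lift_fst_assoc, Category.id_comp]
  refine ⟨H, h₀, h₁, ?_⟩
  apply CatEnrichedOrdinary.Hom.ext
  refine Eq.trans ?_ he
  exact congrArg SSet.Truncated.HomotopyCategory.homMk
    (SSet.Truncated.Edge.ext (x := (edgeOfHomotopy H h₀ h₁).toTruncated) (y := e) hH)

/-- This is the bridge between 2-cells and simplices used throughout: composition is witnessed on
the nose by one 2-simplex of `Y ^ X`, with no chain of intermediate homotopies. -/
lemma cellOfHomotopy_comp_iff {h k l : X ⟶ Y} {H₀₁ H₁₂ H₀₂ : X.sSet ⊗ Δ[1] ⟶ Y.sSet}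
    (h₀ : SSet.ι₀ ≫ H₀₁ = map h) (h₁ : SSet.ι₁ ≫ H₀₁ = map k)
    (h₁' : SSet.ι₀ ≫ H₁₂ = map k) (h₂ : SSet.ι₁ ≫ H₁₂ = map l)
    (h₀' : SSet.ι₀ ≫ H₀₂ = map h) (h₂' : SSet.ι₁ ≫ H₀₂ = map l) :
    cellOfHomotopy H₀₁ h₀ h₁ ≫ cellOfHomotopy H₁₂ h₁' h₂ = cellOfHomotopy H₀₂ h₀' h₂' ↔
      ∃ S : X.sSet ⊗ Δ[2] ⟶ Y.sSet,
        X.sSet ◁ SSet.stdSimplex.δ 2 ≫ S = H₀₁ ∧ X.sSet ◁ SSet.stdSimplex.δ 0 ≫ S = H₁₂ ∧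
          X.sSet ◁ SSet.stdSimplex.δ 1 ≫ S = H₀₂ := by
  have e := nonempty_compStruct_iff (edgeOfHomotopy H₀₁ h₀ h₁).toTruncated
    (edgeOfHomotopy H₁₂ h₁' h₂).toTruncated (edgeOfHomotopy H₀₂ h₀' h₂').toTruncated
  constructor
  · intro hc
    obtain ⟨c⟩ := e.2 (congrArg CatEnrichedOrdinary.Hom.base hc)
    obtain ⟨S, hS⟩ := (cylinderEquiv 2).surjective c.simplex
    refine ⟨S, (cylinderEquiv 1).injective ?_, (cylinderEquiv 1).injective ?_,
      (cylinderEquiv 1).injective ?_⟩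
    · exact Eq.trans (by rw [← cylinderEquiv_δ, hS]; rfl) c.d₂
    · exact Eq.trans (by rw [← cylinderEquiv_δ, hS]; rfl) c.d₀
    · exact Eq.trans (by rw [← cylinderEquiv_δ, hS]; rfl) c.d₁
  · rintro ⟨S, rfl, rfl, rfl⟩
    exact CatEnrichedOrdinary.Hom.ext _ _ (e.1 ⟨⟨cylinderEquiv 2 S, rfl, rfl, rfl⟩⟩)

lemma cellOfHomotopy_id (h : X ⟶ Y) :
    cellOfHomotopy (fst X.sSet Δ[1] ≫ map h) (h := h) (k := h) rfl rfl = 𝟙 h := by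
  refine CatEnrichedOrdinary.Hom.ext _ _ ?_
  exact SSet.Truncated.HomotopyCategory.homMk_id _

lemma cellOfHomotopy_whiskerRight {h k : X ⟶ Y} (H : X.sSet ⊗ Δ[1] ⟶ Y.sSet)
    (h₀ : SSet.ι₀ ≫ H = map h) (h₁ : SSet.ι₁ ≫ H = map k) (f : Y ⟶ Z) :
    cellOfHomotopy H h₀ h₁ ▷ f = cellOfHomotopy (h := h ≫ f) (k := k ≫ f) (H ≫ map f)
      (congrArg (· ≫ map f) h₀) (congrArg (· ≫ map f) h₁) := by
  rfl

lemma whiskerLeft_cellOfHomotopy {h k : Y ⟶ Z} (H : Y.sSet ⊗ Δ[1] ⟶ Z.sSet)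
    (h₀ : SSet.ι₀ ≫ H = map h) (h₁ : SSet.ι₁ ≫ H = map k) (f : X ⟶ Y) :
    f ◁ cellOfHomotopy H h₀ h₁ = cellOfHomotopy (h := f ≫ h) (k := f ≫ k) (map f ▷ Δ[1] ≫ H)
      (congrArg (map f ≫ ·) h₀) (congrArg (map f ≫ ·) h₁) := by
  rfl

end QCat₂

end

/-! ### The strict universal property of the comma simplicial set. -/

noncomputable section

open MonoidalCategory CartesianMonoidalCategory Simplicial

section CommaMaps

variable {A B C : SSet.{u}} (f : B ⟶ A) (g : C ⟶ A)

/-- The projection of the comma construction to the product. -/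
def commaSSetProj : commaSSet f g ⟶ C ⊗ B := Limits.pullback.fst (g ⊗ₘ f) (pathEnds A)

/-- The projection of the comma construction to the path object. -/
def commaSSetArrow : commaSSet f g ⟶ (ihom Δ[1]).obj A :=
  Limits.pullback.snd (g ⊗ₘ f) (pathEnds A)

/-- The domain projection of the comma construction. -/
def commaSSetSrc : commaSSet f g ⟶ B := commaSSetProj f g ≫ snd C B

/-- The codomain projection of the comma construction. -/
def commaSSetTgt : commaSSet f g ⟶ C := commaSSetProj f g ≫ fst C B

/-- The canonical homotopy on the comma construction. -/
def commaSSetPath : commaSSet f g ⊗ Δ[1] ⟶ A :=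
  (β_ _ _).hom ≫ MonoidalClosed.uncurry (commaSSetArrow f g)

lemma commaSSetArrow_src : commaSSetArrow f g ≫ pathSrc A = commaSSetSrc f g ≫ f := by
  have : commaSSetProj f g ≫ (g ⊗ₘ f) = commaSSetArrow f g ≫ pathEnds A :=
    Limits.pullback.condition
  simpa [pathEnds, commaSSetSrc] using (this =≫ snd _ _).symm

lemma commaSSetArrow_tgt : commaSSetArrow f g ≫ pathTgt A = commaSSetTgt f g ≫ g := by
  have : commaSSetProj f g ≫ (g ⊗ₘ f) = commaSSetArrow f g ≫ pathEnds A :=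
    Limits.pullback.condition
  simpa [pathEnds, commaSSetTgt] using (this =≫ fst _ _).symm

variable {V : SSet.{u}}

lemma whiskerRight_commaSSetPath (a : V ⟶ commaSSet f g) :
    a ▷ Δ[1] ≫ commaSSetPath f g =
      (β_ _ _).hom ≫ MonoidalClosed.uncurry (a ≫ commaSSetArrow f g) := by
  rw [MonoidalClosed.uncurry_natural_left, commaSSetPath,
    BraidedCategory.braiding_naturality_left_assoc]

lemma ι₀_commaSSetPath : SSet.ι₀ ≫ commaSSetPath f g = commaSSetSrc f g ≫ f := by
  rw [← commaSSetArrow_src, comp_pathSrc, commaSSetPath]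

lemma ι₁_commaSSetPath : SSet.ι₁ ≫ commaSSetPath f g = commaSSetTgt f g ≫ g := by
  rw [← commaSSetArrow_tgt, comp_pathTgt, commaSSetPath]

variable {f g} in
lemma commaSSet_hom_ext {a a' : V ⟶ commaSSet f g}
    (h₀ : a ≫ commaSSetSrc f g = a' ≫ commaSSetSrc f g)
    (h₁ : a ≫ commaSSetTgt f g = a' ≫ commaSSetTgt f g)
    (h : a ▷ Δ[1] ≫ commaSSetPath f g = a' ▷ Δ[1] ≫ commaSSetPath f g) : a = a' := by
  have e₁ : a ≫ commaSSetProj f g = a' ≫ commaSSetProj f g := by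
    apply CartesianMonoidalCategory.hom_ext
    · simpa [commaSSetTgt] using h₁
    · simpa [commaSSetSrc] using h₀
  have e₂ : a ≫ commaSSetArrow f g = a' ≫ commaSSetArrow f g := by
    rw [whiskerRight_commaSSetPath, whiskerRight_commaSSetPath, cancel_epi] at h
    exact MonoidalClosed.uncurry_injective h
  exact Limits.pullback.hom_ext e₁ e₂

/-- With `commaSSet_hom_ext`, this restates the pullback with the path object transposed: a map into
the comma is a triple consisting of a map to `B`, a map to `C` and a homotopy in `A`. -/
lemma exists_commaSSetLift (b : V ⟶ B) (c : V ⟶ C) (h : V ⊗ Δ[1] ⟶ A)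
    (h₀ : SSet.ι₀ ≫ h = b ≫ f) (h₁ : SSet.ι₁ ≫ h = c ≫ g) :
    ∃ a : V ⟶ commaSSet f g, a ≫ commaSSetSrc f g = b ∧ a ≫ commaSSetTgt f g = c ∧
      a ▷ Δ[1] ≫ commaSSetPath f g = h := by
  have w : lift c b ≫ (g ⊗ₘ f) = MonoidalClosed.curry ((β_ _ _).hom ≫ h) ≫ pathEnds A := by
    apply CartesianMonoidalCategory.hom_ext
    · simp [pathEnds, comp_pathTgt, h₁]
    · simp [pathEnds, comp_pathSrc, h₀]
  let a : V ⟶ commaSSet f g := Limits.pullback.lift _ _ w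
  have e₁ : a ≫ commaSSetProj f g = lift c b := Limits.pullback.lift_fst _ _ _
  have e₂ : a ≫ commaSSetArrow f g = MonoidalClosed.curry ((β_ _ _).hom ≫ h) :=
    Limits.pullback.lift_snd _ _ _
  refine ⟨a, ?_, ?_, ?_⟩
  · rw [commaSSetSrc, reassoc_of% e₁, lift_snd]
  · rw [commaSSetTgt, reassoc_of% e₁, lift_fst]
  · rw [whiskerRight_commaSSetPath, e₂]
    simp

end CommaMaps

/-! ### Maps of cylinders and prisms induced by monotone maps of vertices. -/

section Prisms

variable (X : SSet.{u})

/-- The map `X × Δ[n] ⟶ X × Δ[m]` given by a monotone map on vertices. -/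
def cylinderMap {n m : ℕ} (θ : Fin (n + 1) →o Fin (m + 1)) : X ⊗ Δ[n] ⟶ X ⊗ Δ[m] :=
  X ◁ SSet.stdSimplex.map (SimplexCategory.Hom.mk θ)

/-- The map `X × Δ[n] × Δ[1] ⟶ X × Δ[m]` given by a monotone map on vertices. -/
def prismMap {n m : ℕ} (φ : Fin (n + 1) × Fin 2 →o Fin (m + 1)) :
    (X ⊗ Δ[n]) ⊗ Δ[1] ⟶ X ⊗ Δ[m] where
  app _ := ↾fun x ↦ (x.1.1, SSet.stdSimplex.objEquiv.symm (SimplexCategory.Hom.mk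
    (φ.comp ((SSet.stdSimplex.objEquiv x.1.2).toOrderHom.prod
      (SSet.stdSimplex.objEquiv x.2).toOrderHom))))
  naturality _ _ _ := rfl

lemma cylinderMap_id (n : ℕ) : cylinderMap X (OrderHom.id : Fin (n + 1) →o Fin (n + 1)) = 𝟙 _ := by
  rw [cylinderMap, SSet.stdSimplex.map_id, MonoidalCategory.whiskerLeft_id]

lemma whiskerLeft_δ {n : ℕ} (i : Fin (n + 2)) :
    X ◁ SSet.stdSimplex.δ i = cylinderMap X (SimplexCategory.δ i).toOrderHom := rfl

/-- This and the similar rules turn every identity between maps of cylinders and prisms into an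
equality of monotone maps between finite posets, which `decide` then settles. -/
lemma cylinderMap_prismMap {k n m : ℕ} (θ : Fin (k + 1) →o Fin (n + 1))
    (φ : Fin (n + 1) × Fin 2 →o Fin (m + 1)) :
    cylinderMap X θ ▷ Δ[1] ≫ prismMap X φ =
      prismMap X (φ.comp (θ.prodMap OrderHom.id)) := rfl

lemma prismMap_cylinderMap {n m k : ℕ} (θ : Fin (m + 1) →o Fin (k + 1))
    (φ : Fin (n + 1) × Fin 2 →o Fin (m + 1)) :
    prismMap X φ ≫ cylinderMap X θ = prismMap X (θ.comp φ) := rfl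

lemma ι₀_prismMap {n m : ℕ} (φ : Fin (n + 1) × Fin 2 →o Fin (m + 1)) :
    SSet.ι₀ ≫ prismMap X φ =
      cylinderMap X (φ.comp (OrderHom.id.prod (OrderHom.const _ 0))) := rfl

lemma ι₁_prismMap {n m : ℕ} (φ : Fin (n + 1) × Fin 2 →o Fin (m + 1)) :
    SSet.ι₁ ≫ prismMap X φ =
      cylinderMap X (φ.comp (OrderHom.id.prod (OrderHom.const _ 1))) := rfl

lemma fst_whiskerRight (n : ℕ) : fst X Δ[n] ▷ Δ[1] = prismMap X (m := 1) OrderHom.snd := by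
  ext k x
  · rfl
  · rw [whiskerRight_snd]
    apply SSet.stdSimplex.objEquiv.injective
    apply SimplexCategory.Hom.ext
    apply OrderHom.ext
    funext j
    rfl

lemma cylinderMap_comp_assoc {n m k : ℕ} (θ : Fin (n + 1) →o Fin (m + 1))
    (θ' : Fin (m + 1) →o Fin (k + 1)) {Z : SSet.{u}}
    (S : X ⊗ Δ[k] ⟶ Z) : cylinderMap X θ ≫ cylinderMap X θ' ≫ S = 
      cylinderMap X (θ'.comp θ) ≫ S := rfl

lemma cylinderMap_prismMap_assoc {k n m : ℕ} (θ : Fin (k + 1) →o Fin (n + 1))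
    (φ : Fin (n + 1) × Fin 2 →o Fin (m + 1)) {Z : SSet.{u}}
    (S : X ⊗ Δ[m] ⟶ Z) : cylinderMap X θ ▷ Δ[1] ≫ prismMap X φ ≫ S = 
      prismMap X (φ.comp (θ.prodMap OrderHom.id)) ≫ S := rfl

lemma prismMap_cylinderMap_assoc {n m k : ℕ} (θ : Fin (m + 1) →o Fin (k + 1))
    (φ : Fin (n + 1) × Fin 2 →o Fin (m + 1)) {Z : SSet.{u}}
    (S : X ⊗ Δ[k] ⟶ Z) : prismMap X φ ≫ cylinderMap X θ ≫ S = prismMap X (θ.comp φ) ≫ S := rfl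

lemma ι₀_prismMap_assoc {n m : ℕ} (φ : Fin (n + 1) × Fin 2 →o Fin (m + 1)) {Z : SSet.{u}}
    (S : X ⊗ Δ[m] ⟶ Z) : SSet.ι₀ ≫ prismMap X φ ≫ S = 
      cylinderMap X (φ.comp (OrderHom.id.prod (OrderHom.const _ 0))) ≫ S := rfl

lemma ι₀_whiskerRight_prismMap_assoc {m : ℕ} (φ : Fin 2 × Fin 2 →o Fin (m + 1)) {Z : SSet.{u}}
    (S : X ⊗ Δ[m] ⟶ Z) : (SSet.ι₀ : X ⟶ _) ▷ Δ[1] ≫ prismMap X φ ≫ S = 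
      cylinderMap X (φ.comp ((OrderHom.const _ 0).prod OrderHom.id)) ≫ S := rfl

lemma fst_ι₀_assoc (n : ℕ) {Z : SSet.{u}}
    (S : X ⊗ Δ[1] ⟶ Z) : fst X Δ[n] ≫ SSet.ι₀ ≫ S = 
      cylinderMap X (OrderHom.const (Fin (n + 1)) (0 : Fin 2)) ≫ S := rfl

lemma ι₁_prismMap_assoc {n m : ℕ} (φ : Fin (n + 1) × Fin 2 →o Fin (m + 1)) {Z : SSet.{u}}
    (S : X ⊗ Δ[m] ⟶ Z) : SSet.ι₁ ≫ prismMap X φ ≫ S = 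
      cylinderMap X (φ.comp (OrderHom.id.prod (OrderHom.const _ 1))) ≫ S := rfl

lemma ι₁_whiskerRight_prismMap_assoc {m : ℕ} (φ : Fin 2 × Fin 2 →o Fin (m + 1)) {Z : SSet.{u}}
    (S : X ⊗ Δ[m] ⟶ Z) : (SSet.ι₁ : X ⟶ _) ▷ Δ[1] ≫ prismMap X φ ≫ S = 
      cylinderMap X (φ.comp ((OrderHom.const _ 1).prod OrderHom.id)) ≫ S := rfl

lemma fst_ι₁_assoc (n : ℕ) {Z : SSet.{u}}
    (S : X ⊗ Δ[1] ⟶ Z) : fst X Δ[n] ≫ SSet.ι₁ ≫ S = 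
      cylinderMap X (OrderHom.const (Fin (n + 1)) (1 : Fin 2)) ≫ S := rfl

/-- The map from the square to the triangle which collapses the edge `(0, 0) ⟶ (1, 0)`. -/
def upperTriangle : Fin 2 × Fin 2 →o Fin 3 := ⟨fun x ↦ ![0, x.1.succ] x.2, by decide⟩

/-- The map from the square to the triangle which collapses the edge `(0, 1) ⟶ (1, 1)`. -/
def lowerTriangle : Fin 2 × Fin 2 →o Fin 3 := ⟨fun x ↦ ![x.1.castSucc, 2] x.2, by decide⟩

/-- The map from the prism to the tetrahedron which collapses the face with last coordinate `0`. -/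
def upperTetrahedron : Fin 3 × Fin 2 →o Fin 4 := ⟨fun x ↦ ![0, x.1.succ] x.2, by decide⟩

/-- The map from the prism to the tetrahedron which collapses the face with last coordinate `1`. -/
def lowerTetrahedron : Fin 3 × Fin 2 →o Fin 4 := ⟨fun x ↦ ![x.1.castSucc, 3] x.2, by decide⟩

end Prisms

end

/-! ### Triangular edges of the comma, horn filling and factorization. -/

noncomputable section

open MonoidalCategory CartesianMonoidalCategory Simplicial

section CommaEdges

variable {A B C X : SSet.{u}} {f : B ⟶ A} {g : C ⟶ A}

/-- An edge of `(f ↓ g) ^ X` which is constant on the codomain and whose square factors through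
`lowerTriangle`. -/
def IsLowerEdge (E : X ⊗ Δ[1] ⟶ commaSSet f g) : Prop :=
  E ≫ commaSSetTgt f g = fst X Δ[1] ≫ SSet.ι₁ ≫ E ≫ commaSSetTgt f g ∧
    ∃ S : X ⊗ Δ[2] ⟶ A, E ▷ Δ[1] ≫ commaSSetPath f g = prismMap X lowerTriangle ≫ S

/-- An edge of `(f ↓ g) ^ X` which is constant on the domain and whose square factors through
`upperTriangle`. -/
def IsUpperEdge (E : X ⊗ Δ[1] ⟶ commaSSet f g) : Prop :=
  E ≫ commaSSetSrc f g = fst X Δ[1] ≫ SSet.ι₀ ≫ E ≫ commaSSetSrc f g ∧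
    ∃ S : X ⊗ Δ[2] ⟶ A, E ▷ Δ[1] ≫ commaSSetPath f g = prismMap X upperTriangle ≫ S

/-- An edge of the comma is a square in `A` with its horizontal sides lifted to `B` and `C`. When
the side in `C` is constant, the square may be taken to be a 2-simplex with one side collapsed. The
faces 2, 0, 1 of `S` are then the side from `B`, the final arrow and the initial arrow. -/
lemma exists_isLowerEdge {a a' : X ⟶ commaSSet f g} (h : a ≫ commaSSetTgt f g = a' ≫ commaSSetTgt f g)
    (T : X ⊗ Δ[1] ⟶ B) (hT₀ : SSet.ι₀ ≫ T = a ≫ commaSSetSrc f g)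
    (hT₁ : SSet.ι₁ ≫ T = a' ≫ commaSSetSrc f g) (S : X ⊗ Δ[2] ⟶ A)
    (h₂ : X ◁ SSet.stdSimplex.δ 2 ≫ S = T ≫ f)
    (h₀ : X ◁ SSet.stdSimplex.δ 0 ≫ S = a' ▷ Δ[1] ≫ commaSSetPath f g)
    (h₁ : X ◁ SSet.stdSimplex.δ 1 ≫ S = a ▷ Δ[1] ≫ commaSSetPath f g) :
    ∃ E : X ⊗ Δ[1] ⟶ commaSSet f g, SSet.ι₀ ≫ E = a ∧ SSet.ι₁ ≫ E = a' ∧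
      E ≫ commaSSetSrc f g = T ∧ E ≫ commaSSetTgt f g = fst X Δ[1] ≫ a' ≫ commaSSetTgt f g := by
  obtain ⟨E, e₀, e₁, e⟩ := exists_commaSSetLift f g T (fst X Δ[1] ≫ a' ≫ commaSSetTgt f g)
    (prismMap X lowerTriangle ≫ S) (by
      rw [ι₀_prismMap_assoc, ← h₂, whiskerLeft_δ]
      exact congrArg (cylinderMap X · ≫ S) (by decide)) (by
      rw [Category.assoc, Category.assoc, ← ι₁_commaSSetPath, ← SSet.ι₁_comp_assoc, ← h₀,
        whiskerLeft_δ, fst_ι₁_assoc, cylinderMap_comp_assoc, ι₁_prismMap_assoc]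
      exact congrArg (cylinderMap X · ≫ S) (by decide))
  refine ⟨E, commaSSet_hom_ext ?_ ?_ ?_, commaSSet_hom_ext ?_ ?_ ?_, e₀, e₁⟩
  · rw [Category.assoc, e₀, hT₀]
  · rw [Category.assoc, e₁, h]
    rfl
  · rw [comp_whiskerRight, Category.assoc, e, ι₀_whiskerRight_prismMap_assoc, ← h₁,
      whiskerLeft_δ]
    exact congrArg (cylinderMap X · ≫ S) (by decide)
  · rw [Category.assoc, e₀, hT₁]
  · rw [Category.assoc, e₁]
    rfl
  · rw [comp_whiskerRight, Category.assoc, e, ι₁_whiskerRight_prismMap_assoc, ← h₀,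
      whiskerLeft_δ]
    exact congrArg (cylinderMap X · ≫ S) (by decide)

/-- The dual case: the side in `B` is constant, and the faces 2, 0, 1 of `S` are the initial arrow,
the side from `C` and the final arrow. -/
lemma exists_isUpperEdge {a a' : X ⟶ commaSSet f g}
    (h : a ≫ commaSSetSrc f g = a' ≫ commaSSetSrc f g)
    (T : X ⊗ Δ[1] ⟶ C) (hT₀ : SSet.ι₀ ≫ T = a ≫ commaSSetTgt f g)
    (hT₁ : SSet.ι₁ ≫ T = a' ≫ commaSSetTgt f g) (S : X ⊗ Δ[2] ⟶ A)
    (h₂ : X ◁ SSet.stdSimplex.δ 2 ≫ S = a ▷ Δ[1] ≫ commaSSetPath f g)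
    (h₀ : X ◁ SSet.stdSimplex.δ 0 ≫ S = T ≫ g)
    (h₁ : X ◁ SSet.stdSimplex.δ 1 ≫ S = a' ▷ Δ[1] ≫ commaSSetPath f g) :
    ∃ E : X ⊗ Δ[1] ⟶ commaSSet f g, SSet.ι₀ ≫ E = a ∧ SSet.ι₁ ≫ E = a' ∧
      E ≫ commaSSetSrc f g = fst X Δ[1] ≫ a ≫ commaSSetSrc f g ∧ E ≫ commaSSetTgt f g = T := by
  obtain ⟨E, e₀, e₁, e⟩ := exists_commaSSetLift f g (fst X Δ[1] ≫ a ≫ commaSSetSrc f g) T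
    (prismMap X upperTriangle ≫ S) (by
      rw [Category.assoc, Category.assoc, ← ι₀_commaSSetPath, ← SSet.ι₀_comp_assoc, ← h₂,
        whiskerLeft_δ, fst_ι₀_assoc, cylinderMap_comp_assoc, ι₀_prismMap_assoc]
      exact congrArg (cylinderMap X · ≫ S) (by decide)) (by
      rw [ι₁_prismMap_assoc, ← h₀, whiskerLeft_δ]
      exact congrArg (cylinderMap X · ≫ S) (by decide))
  refine ⟨E, commaSSet_hom_ext ?_ ?_ ?_, commaSSet_hom_ext ?_ ?_ ?_, e₀, e₁⟩
  · rw [Category.assoc, e₀]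
    rfl
  · rw [Category.assoc, e₁, hT₀]
  · rw [comp_whiskerRight, Category.assoc, e, ι₀_whiskerRight_prismMap_assoc, ← h₂,
      whiskerLeft_δ]
    exact congrArg (cylinderMap X · ≫ S) (by decide)
  · rw [Category.assoc, e₀, ← h]
    rfl
  · rw [Category.assoc, e₁, hT₁]
  · rw [comp_whiskerRight, Category.assoc, e, ι₁_whiskerRight_prismMap_assoc, ← h₁,
      whiskerLeft_δ]
    exact congrArg (cylinderMap X · ≫ S) (by decide)

lemma exists_cylinder_three₁ [SSet.Quasicategory A] (s₀ s₂ s₃ : X ⊗ Δ[2] ⟶ A)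
    (h₁₂ : X ◁ SSet.stdSimplex.δ 2 ≫ s₀ = X ◁ SSet.stdSimplex.δ 0 ≫ s₃)
    (h₁₃ : X ◁ SSet.stdSimplex.δ 1 ≫ s₀ = X ◁ SSet.stdSimplex.δ 0 ≫ s₂)
    (h₂₃ : X ◁ SSet.stdSimplex.δ 2 ≫ s₂ = X ◁ SSet.stdSimplex.δ 2 ≫ s₃) :
    ∃ t : X ⊗ Δ[3] ⟶ A, X ◁ SSet.stdSimplex.δ 0 ≫ t = s₀ ∧
      X ◁ SSet.stdSimplex.δ 2 ≫ t = s₂ ∧ X ◁ SSet.stdSimplex.δ 3 ≫ t = s₃ := by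
  obtain ⟨t, h₀, h₂, h₃⟩ := Quasicategory.exists_three_simplex₁ (cylinderEquiv 2 s₀)
    (cylinderEquiv 2 s₂) (cylinderEquiv 2 s₃) (congrArg (cylinderEquiv 1) h₁₂)
    (congrArg (cylinderEquiv 1) h₁₃) (congrArg (cylinderEquiv 1) h₂₃)
  obtain ⟨t, rfl⟩ := (cylinderEquiv 3).surjective t
  exact ⟨t, (cylinderEquiv 2).injective h₀, (cylinderEquiv 2).injective h₂,
    (cylinderEquiv 2).injective h₃⟩

lemma exists_cylinder_three₂ [SSet.Quasicategory A] (s₀ s₁ s₃ : X ⊗ Δ[2] ⟶ A)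
    (h₀₂ : X ◁ SSet.stdSimplex.δ 2 ≫ s₁ = X ◁ SSet.stdSimplex.δ 1 ≫ s₃)
    (h₁₂ : X ◁ SSet.stdSimplex.δ 2 ≫ s₀ = X ◁ SSet.stdSimplex.δ 0 ≫ s₃)
    (h₂₃ : X ◁ SSet.stdSimplex.δ 0 ≫ s₀ = X ◁ SSet.stdSimplex.δ 0 ≫ s₁) :
    ∃ t : X ⊗ Δ[3] ⟶ A, X ◁ SSet.stdSimplex.δ 0 ≫ t = s₀ ∧
      X ◁ SSet.stdSimplex.δ 1 ≫ t = s₁ ∧ X ◁ SSet.stdSimplex.δ 3 ≫ t = s₃ := by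
  obtain ⟨t, h₀, h₁, h₃⟩ := Quasicategory.exists_three_simplex₂ (cylinderEquiv 2 s₀)
    (cylinderEquiv 2 s₁) (cylinderEquiv 2 s₃) (congrArg (cylinderEquiv 1) h₀₂)
    (congrArg (cylinderEquiv 1) h₁₂) (congrArg (cylinderEquiv 1) h₂₃)
  obtain ⟨t, rfl⟩ := (cylinderEquiv 3).surjective t
  exact ⟨t, (cylinderEquiv 2).injective h₀, (cylinderEquiv 2).injective h₁,
    (cylinderEquiv 2).injective h₃⟩

/-- A right-inverse triangle `R` in `B` lifts to the comma. The 2-simplex sought in the comma is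
encoded by a tetrahedron in `A` whose last vertex is the constant codomain. Three of its faces are
prescribed, and the missing one is the triangle of the new lower edge. -/
lemma IsLowerEdge.exists_section [SSet.Quasicategory A] {E : X ⊗ Δ[1] ⟶ commaSSet f g}
    (hE : IsLowerEdge E) (R : X ⊗ Δ[2] ⟶ B)
    (hR₀ : X ◁ SSet.stdSimplex.δ 0 ≫ R = E ≫ commaSSetSrc f g)
    (hR₁ : X ◁ SSet.stdSimplex.δ 1 ≫ R = fst X Δ[1] ≫ SSet.ι₁ ≫ E ≫ commaSSetSrc f g) :
    ∃ W : X ⊗ Δ[2] ⟶ commaSSet f g, X ◁ SSet.stdSimplex.δ 0 ≫ W = E ∧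
      X ◁ SSet.stdSimplex.δ 1 ≫ W = fst X Δ[1] ≫ SSet.ι₁ ≫ E ∧
      IsLowerEdge (X ◁ SSet.stdSimplex.δ 2 ≫ W) ∧ W ≫ commaSSetSrc f g = R := by
  obtain ⟨hE₁, S, hS⟩ := hE
  have hS₂ : X ◁ SSet.stdSimplex.δ 2 ≫ S = E ≫ commaSSetSrc f g ≫ f := by
    rw [← ι₀_commaSSetPath, ← SSet.ι₀_comp_assoc, hS, ι₀_prismMap_assoc, whiskerLeft_δ]
    exact congrArg (cylinderMap X · ≫ S) (by decide)
  have hS₀ : X ◁ SSet.stdSimplex.δ 0 ≫ S = SSet.ι₁ ▷ Δ[1] ≫ E ▷ Δ[1] ≫ commaSSetPath f g := by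
    rw [hS, ι₁_whiskerRight_prismMap_assoc, whiskerLeft_δ]
    exact congrArg (cylinderMap X · ≫ S) (by decide)
  have hS₁ : E ≫ commaSSetTgt f g ≫ g = cylinderMap X (OrderHom.const _ 2) ≫ S := by
    rw [← ι₁_commaSSetPath, ← SSet.ι₁_comp_assoc, hS, ι₁_prismMap_assoc]
    exact congrArg (cylinderMap X · ≫ S) (by decide)
  obtain ⟨t, ht₀, ht₁, ht₃⟩ := exists_cylinder_three₂ S
    -- Face 3 is the image of `R`, face 0 is the triangle of `E`, and face 1 is degenerate on the
    -- final arrow of `E`. Face 2 is missing, so the horn is inner.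
    (cylinderMap X (SimplexCategory.σ (0 : Fin 2)).toOrderHom ≫ X ◁ SSet.stdSimplex.δ 0 ≫ S)
    (R ≫ f) (by
      rw [← Category.assoc _ R, hR₁]
      simp only [Category.assoc]
      rw [← hS₂]
      simp only [whiskerLeft_δ, cylinderMap_comp_assoc, fst_ι₁_assoc]
      exact congrArg (cylinderMap X · ≫ S) (by decide)) (by
      rw [hS₂, ← Category.assoc _ R, hR₀, Category.assoc]) (by
      simp only [whiskerLeft_δ, cylinderMap_comp_assoc]
      exact congrArg (cylinderMap X · ≫ S) (by decide))
  rw [whiskerLeft_δ] at ht₀ ht₁ ht₃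
  obtain ⟨W, w₀, w₁, w⟩ := exists_commaSSetLift f g R
    (fst X Δ[2] ≫ SSet.ι₁ ≫ E ≫ commaSSetTgt f g) (prismMap X lowerTetrahedron ≫ t) (by
      rw [ι₀_prismMap_assoc, ← ht₃]
      exact congrArg (cylinderMap X · ≫ t) (by decide)) (by
      simp only [Category.assoc]
      rw [hS₁, ← ht₀]
      simp only [ι₁_prismMap_assoc, cylinderMap_comp_assoc, fst_ι₁_assoc]
      exact congrArg (cylinderMap X · ≫ t) (by decide))
  refine ⟨W, commaSSet_hom_ext ?_ ?_ ?_, commaSSet_hom_ext ?_ ?_ ?_, ⟨?_, ?_⟩, w₀⟩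
  · rw [Category.assoc, w₀, hR₀]
  · rw [Category.assoc, w₁, hE₁]
    rfl
  · rw [comp_whiskerRight, Category.assoc, w, hS, ← ht₀, whiskerLeft_δ, cylinderMap_prismMap_assoc,
      prismMap_cylinderMap_assoc]
    exact congrArg (prismMap X · ≫ t) (by decide)
  · rw [Category.assoc, w₀, hR₁]
    simp only [Category.assoc]
  · rw [Category.assoc, w₁]
    rfl
  · simp only [comp_whiskerRight, Category.assoc]
    have e : cylinderMap X (SimplexCategory.δ (1 : Fin 3)).toOrderHom ▷ Δ[1] ≫
        prismMap X lowerTetrahedron ≫ t =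
          prismMap X lowerTriangle ≫ cylinderMap X (SimplexCategory.δ 1).toOrderHom ≫ t := by
      rw [prismMap_cylinderMap_assoc, cylinderMap_prismMap_assoc]
      exact congrArg (prismMap X · ≫ t) (by decide)
    rw [w, ← hS₀, whiskerLeft_δ, whiskerLeft_δ, e, ht₁, fst_whiskerRight, whiskerLeft_δ]
    simp only [prismMap_cylinderMap_assoc]
    exact congrArg (prismMap X · ≫ S) (by decide)
  · simp only [Category.assoc]
    rw [w₁]
    rfl
  · refine ⟨X ◁ SSet.stdSimplex.δ 2 ≫ t, ?_⟩
    rw [comp_whiskerRight, Category.assoc, w, whiskerLeft_δ, whiskerLeft_δ,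
      cylinderMap_prismMap_assoc, prismMap_cylinderMap_assoc]
    exact congrArg (prismMap X · ≫ t) (by decide)

/-- Dual to `IsLowerEdge.exists_section`: the first vertex of the tetrahedron is now the constant
domain, and its opposite face is the image of `R`. The missing face is face 1, again inner, and it
is the triangle of the new upper edge. -/
lemma IsUpperEdge.exists_retraction [SSet.Quasicategory A] {E : X ⊗ Δ[1] ⟶ commaSSet f g}
    (hE : IsUpperEdge E) (R : X ⊗ Δ[2] ⟶ C)
    (hR₂ : X ◁ SSet.stdSimplex.δ 2 ≫ R = E ≫ commaSSetTgt f g)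
    (hR₁ : X ◁ SSet.stdSimplex.δ 1 ≫ R = fst X Δ[1] ≫ SSet.ι₀ ≫ E ≫ commaSSetTgt f g) :
    ∃ W : X ⊗ Δ[2] ⟶ commaSSet f g, X ◁ SSet.stdSimplex.δ 2 ≫ W = E ∧
      X ◁ SSet.stdSimplex.δ 1 ≫ W = fst X Δ[1] ≫ SSet.ι₀ ≫ E ∧
      IsUpperEdge (X ◁ SSet.stdSimplex.δ 0 ≫ W) ∧ W ≫ commaSSetTgt f g = R := by
  obtain ⟨hE₀, S, hS⟩ := hE
  have hS₀ : X ◁ SSet.stdSimplex.δ 0 ≫ S = E ≫ commaSSetTgt f g ≫ g := by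
    rw [← ι₁_commaSSetPath, ← SSet.ι₁_comp_assoc, hS, ι₁_prismMap_assoc, whiskerLeft_δ]
    exact congrArg (cylinderMap X · ≫ S) (by decide)
  have hS₂ : X ◁ SSet.stdSimplex.δ 2 ≫ S = SSet.ι₀ ▷ Δ[1] ≫ E ▷ Δ[1] ≫ commaSSetPath f g := by
    rw [hS, ι₀_whiskerRight_prismMap_assoc, whiskerLeft_δ]
    exact congrArg (cylinderMap X · ≫ S) (by decide)
  have hS₁ : E ≫ commaSSetSrc f g ≫ f = cylinderMap X (OrderHom.const _ 0) ≫ S := by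
    rw [← ι₀_commaSSetPath, ← SSet.ι₀_comp_assoc, hS, ι₀_prismMap_assoc]
    exact congrArg (cylinderMap X · ≫ S) (by decide)
  obtain ⟨t, ht₀, ht₂, ht₃⟩ := exists_cylinder_three₁ (R ≫ g)
    (cylinderMap X (SimplexCategory.σ (1 : Fin 2)).toOrderHom ≫ X ◁ SSet.stdSimplex.δ 2 ≫ S) S
    (by rw [hS₀, ← Category.assoc _ R, hR₂, Category.assoc]) (by
      rw [← Category.assoc _ R, hR₁]
      simp only [Category.assoc]
      rw [← hS₀]
      simp only [whiskerLeft_δ, cylinderMap_comp_assoc, fst_ι₀_assoc]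
      exact congrArg (cylinderMap X · ≫ S) (by decide)) (by
      simp only [whiskerLeft_δ, cylinderMap_comp_assoc]
      exact congrArg (cylinderMap X · ≫ S) (by decide))
  rw [whiskerLeft_δ] at ht₀ ht₂ ht₃
  obtain ⟨W, w₀, w₁, w⟩ := exists_commaSSetLift f g
    (fst X Δ[2] ≫ SSet.ι₀ ≫ E ≫ commaSSetSrc f g) R (prismMap X upperTetrahedron ≫ t) (by
      simp only [Category.assoc]
      rw [hS₁, ← ht₃]
      simp only [ι₀_prismMap_assoc, cylinderMap_comp_assoc, fst_ι₀_assoc]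
      exact congrArg (cylinderMap X · ≫ t) (by decide)) (by
      rw [ι₁_prismMap_assoc, ← ht₀]
      exact congrArg (cylinderMap X · ≫ t) (by decide))
  refine ⟨W, commaSSet_hom_ext ?_ ?_ ?_, commaSSet_hom_ext ?_ ?_ ?_, ⟨?_, ?_⟩, w₁⟩
  · rw [Category.assoc, w₀, hE₀]
    rfl
  · rw [Category.assoc, w₁, hR₂]
  · rw [comp_whiskerRight, Category.assoc, w, hS, ← ht₃, whiskerLeft_δ, cylinderMap_prismMap_assoc,
      prismMap_cylinderMap_assoc]
    exact congrArg (prismMap X · ≫ t) (by decide)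
  · rw [Category.assoc, w₀]
    rfl
  · rw [Category.assoc, w₁, hR₁]
    simp only [Category.assoc]
  · simp only [comp_whiskerRight, Category.assoc]
    have e : cylinderMap X (SimplexCategory.δ (1 : Fin 3)).toOrderHom ▷ Δ[1] ≫
        prismMap X upperTetrahedron ≫ t =
          prismMap X upperTriangle ≫ cylinderMap X (SimplexCategory.δ 2).toOrderHom ≫ t := by
      rw [prismMap_cylinderMap_assoc, cylinderMap_prismMap_assoc]
      exact congrArg (prismMap X · ≫ t) (by decide)
    rw [w, ← hS₂, whiskerLeft_δ, whiskerLeft_δ, e, ht₂, fst_whiskerRight, whiskerLeft_δ]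
    simp only [prismMap_cylinderMap_assoc]
    exact congrArg (prismMap X · ≫ S) (by decide)
  · simp only [Category.assoc]
    rw [w₀]
    rfl
  · refine ⟨X ◁ SSet.stdSimplex.δ 1 ≫ t, ?_⟩
    rw [comp_whiskerRight, Category.assoc, w, whiskerLeft_δ, whiskerLeft_δ,
      cylinderMap_prismMap_assoc, prismMap_cylinderMap_assoc]
    exact congrArg (prismMap X · ≫ t) (by decide)

/-- The first coordinate of the map from the prism to the square which sends the two halves of
the prism to the two halves of the square. -/
def prismToSquare : Fin 3 × Fin 2 →o Fin 2 := ⟨fun x ↦ ![![0, 0, 1] x.1, ![0, 1, 1] x.1] x.2,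
  by decide⟩

lemma fst_eq_prismMap (n : ℕ) :
    fst (X ⊗ Δ[n]) Δ[1] = prismMap X (m := n) OrderHom.fst := by
  ext k x
  · rfl
  · apply SSet.stdSimplex.objEquiv.injective
    apply SimplexCategory.Hom.ext
    apply OrderHom.ext
    funext j
    rfl

lemma prismMap_snd_snd (n : ℕ) :
    prismMap X (n := n) (m := 1) OrderHom.snd ≫ snd X Δ[1] = snd (X ⊗ Δ[n]) Δ[1] := by
  rw [← fst_whiskerRight, whiskerRight_snd]

/-- The middle vertex of `W` is the diagonal of the square of `E`. First the codomain moves while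
the domain is fixed, then the domain moves while the codomain is fixed. No horn is filled, since `W`
is the pullback of the square along an explicit map `q` of prisms. -/
lemma exists_factorization (E : X ⊗ Δ[1] ⟶ commaSSet f g) :
    ∃ W : X ⊗ Δ[2] ⟶ commaSSet f g, X ◁ SSet.stdSimplex.δ 1 ≫ W = E ∧
      IsUpperEdge (X ◁ SSet.stdSimplex.δ 2 ≫ W) ∧ IsLowerEdge (X ◁ SSet.stdSimplex.δ 0 ≫ W) ∧
      X ◁ SSet.stdSimplex.δ 2 ≫ W ≫ commaSSetTgt f g = E ≫ commaSSetTgt f g ∧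
      X ◁ SSet.stdSimplex.δ 0 ≫ W ≫ commaSSetSrc f g = E ≫ commaSSetSrc f g := by
  -- On domains `q` repeats vertex 0 and on codomains it repeats vertex 1, so the three arrows run
  -- from 0, 0, 1 to 0, 1, 1.
  let q : (X ⊗ Δ[2]) ⊗ Δ[1] ⟶ (X ⊗ Δ[1]) ⊗ Δ[1] := lift (prismMap X prismToSquare) (snd _ _)
  let σ₀ := (SimplexCategory.σ (0 : Fin 2)).toOrderHom
  let σ₁ := (SimplexCategory.σ (1 : Fin 2)).toOrderHom
  have hq₀ : SSet.ι₀ ≫ q = SSet.ι₀ ≫ cylinderMap X σ₀ ▷ Δ[1] := by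
    apply CartesianMonoidalCategory.hom_ext
    · rw [Category.assoc, lift_fst, ι₀_prismMap]
      exact congrArg (cylinderMap X ·) (by decide)
    · rfl
  have hq₁ : SSet.ι₁ ≫ q = SSet.ι₁ ≫ cylinderMap X σ₁ ▷ Δ[1] := by
    apply CartesianMonoidalCategory.hom_ext
    · rw [Category.assoc, lift_fst, ι₁_prismMap]
      exact congrArg (cylinderMap X ·) (by decide)
    · rfl
  have hδ₁ : cylinderMap X (SimplexCategory.δ (1 : Fin 3)).toOrderHom ▷ Δ[1] ≫ q = 𝟙 _ := by
    apply CartesianMonoidalCategory.hom_ext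
    · rw [Category.assoc, lift_fst, cylinderMap_prismMap, Category.id_comp, fst_eq_prismMap]
      exact congrArg (prismMap X ·) (by decide)
    · rw [Category.assoc, lift_snd, whiskerRight_snd, Category.id_comp]
  have hδ₂ : cylinderMap X (SimplexCategory.δ (2 : Fin 3)).toOrderHom ▷ Δ[1] ≫ q =
      prismMap X upperTriangle ≫ lift (cylinderMap X σ₀) (cylinderMap X σ₁ ≫ snd X Δ[1]) := by
    apply CartesianMonoidalCategory.hom_ext
    · rw [Category.assoc, Category.assoc, lift_fst, lift_fst, cylinderMap_prismMap,
        prismMap_cylinderMap]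
      exact congrArg (prismMap X ·) (by decide)
    · rw [Category.assoc, Category.assoc, lift_snd, lift_snd, whiskerRight_snd,
        prismMap_cylinderMap_assoc, ← prismMap_snd_snd]
      exact congrArg (prismMap X · ≫ snd X Δ[1]) (by decide)
  have hδ₀ : cylinderMap X (SimplexCategory.δ (0 : Fin 3)).toOrderHom ▷ Δ[1] ≫ q =
      prismMap X lowerTriangle ≫ lift (cylinderMap X σ₁) (cylinderMap X σ₀ ≫ snd X Δ[1]) := by
    apply CartesianMonoidalCategory.hom_ext
    · rw [Category.assoc, Category.assoc, lift_fst, lift_fst, cylinderMap_prismMap,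
        prismMap_cylinderMap]
      exact congrArg (prismMap X ·) (by decide)
    · rw [Category.assoc, Category.assoc, lift_snd, lift_snd, whiskerRight_snd,
        prismMap_cylinderMap_assoc, ← prismMap_snd_snd]
      exact congrArg (prismMap X · ≫ snd X Δ[1]) (by decide)
  obtain ⟨W, w₀, w₁, w⟩ := exists_commaSSetLift f g
    (cylinderMap X σ₀ ≫ E ≫ commaSSetSrc f g) (cylinderMap X σ₁ ≫ E ≫ commaSSetTgt f g)
    (q ≫ E ▷ Δ[1] ≫ commaSSetPath f g)
    (by
      simp only [Category.assoc]
      rw [← ι₀_commaSSetPath, ← SSet.ι₀_comp_assoc, ← SSet.ι₀_comp_assoc, reassoc_of% hq₀])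
    (by
      simp only [Category.assoc]
      rw [← ι₁_commaSSetPath, ← SSet.ι₁_comp_assoc, ← SSet.ι₁_comp_assoc, reassoc_of% hq₁])
  have hσ {θ : Fin 2 →o Fin 3} {σ : Fin 3 →o Fin 2} (h : σ.comp θ = OrderHom.id)
      {Z : SSet.{u}} (T : X ⊗ Δ[1] ⟶ Z) : cylinderMap X θ ≫ cylinderMap X σ ≫ T = T := by
    rw [cylinderMap_comp_assoc, h, cylinderMap_id, Category.id_comp]
  refine ⟨W, commaSSet_hom_ext ?_ ?_ ?_, ⟨?_, ⟨?_, ?_⟩⟩, ⟨?_, ⟨?_, ?_⟩⟩, ?_, ?_⟩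
  · rw [Category.assoc, w₀, whiskerLeft_δ]
    exact hσ (by decide) _
  · rw [Category.assoc, w₁, whiskerLeft_δ]
    exact hσ (by decide) _
  · rw [comp_whiskerRight, Category.assoc, w, whiskerLeft_δ, reassoc_of% hδ₁]
  · rw [Category.assoc, w₀, whiskerLeft_δ, fst_ι₀_assoc, cylinderMap_comp_assoc,
      cylinderMap_comp_assoc]
    exact congrArg (cylinderMap X · ≫ E ≫ commaSSetSrc f g) (by decide)
  · exact lift (cylinderMap X σ₀) (cylinderMap X σ₁ ≫ snd X Δ[1]) ≫ E ▷ Δ[1] ≫ commaSSetPath f g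
  · rw [comp_whiskerRight, Category.assoc, w, whiskerLeft_δ, reassoc_of% hδ₂]
  · rw [Category.assoc, w₁, whiskerLeft_δ, fst_ι₁_assoc, cylinderMap_comp_assoc,
      cylinderMap_comp_assoc]
    exact congrArg (cylinderMap X · ≫ E ≫ commaSSetTgt f g) (by decide)
  · exact lift (cylinderMap X σ₁) (cylinderMap X σ₀ ≫ snd X Δ[1]) ≫ E ▷ Δ[1] ≫ commaSSetPath f g
  · rw [comp_whiskerRight, Category.assoc, w, whiskerLeft_δ, reassoc_of% hδ₀]
  · rw [w₁, whiskerLeft_δ]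
    exact hσ (by decide) _
  · rw [w₀, whiskerLeft_δ]
    exact hσ (by decide) _

end CommaEdges

end

/-! ### The formal argument in a bicategory with weak commas. -/

section WeakComma

open Bicategory

variable {𝓑 : Type u} [Bicategory.{w, v} 𝓑] {A B C E : 𝓑} {f : B ⟶ A} {g : C ⟶ A}
  {q₀ : E ⟶ B} {q₁ : E ⟶ C}

/-- The restriction of a cell `ψ : q₀ ≫ f ⟶ q₁ ≫ g` along a 1-cell. -/
def precompCell (ψ : q₀ ≫ f ⟶ q₁ ≫ g) {X : 𝓑} (a : X ⟶ E) : (a ≫ q₀) ≫ f ⟶ (a ≫ q₁) ≫ g :=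
  (α_ a q₀ f).hom ≫ a ◁ ψ ≫ (α_ a q₁ g).inv

/-- The weak universal property of a comma object. -/
structure IsWeakComma (ψ : q₀ ≫ f ⟶ q₁ ≫ g) : Prop where
  exists_hom {X : 𝓑} (b : X ⟶ B) (c : X ⟶ C) (χ : b ≫ f ⟶ c ≫ g) :
    ∃ (a : X ⟶ E) (i₀ : a ≫ q₀ ≅ b) (i₁ : a ≫ q₁ ≅ c),
      precompCell ψ a ≫ i₁.hom ▷ g = i₀.hom ▷ f ≫ χ
  exists_cell {X : 𝓑} {a a' : X ⟶ E} (τ₀ : a ≫ q₀ ⟶ a' ≫ q₀) (τ₁ : a ≫ q₁ ⟶ a' ≫ q₁)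
    (h : τ₀ ▷ f ≫ precompCell ψ a' = precompCell ψ a ≫ τ₁ ▷ g) :
    ∃ τ : a ⟶ a', τ ▷ q₀ = τ₀ ∧ τ ▷ q₁ = τ₁
  isIso {X : 𝓑} {a a' : X ⟶ E} (τ : a ⟶ a') (h₀ : IsIso (τ ▷ q₀)) (h₁ : IsIso (τ ▷ q₁)) : IsIso τ

variable {X Y : 𝓑}

lemma precompCell_naturality (ψ : q₀ ≫ f ⟶ q₁ ≫ g) {a a' : X ⟶ E} (τ : a ⟶ a') :
    (τ ▷ q₀) ▷ f ≫ precompCell ψ a' = precompCell ψ a ≫ (τ ▷ q₁) ▷ g := by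
  simp only [precompCell, Category.assoc]
  rw [associator_naturality_left_assoc, ← whisker_exchange_assoc, associator_inv_naturality_left]

lemma precompCell_id (ψ : q₀ ≫ f ⟶ q₁ ≫ g) :
    precompCell ψ (𝟙 E) = (λ_ q₀).hom ▷ f ≫ ψ ≫ (λ_ q₁).inv ▷ g := by
  simp [precompCell]

lemma precompCell_comp (ψ : q₀ ≫ f ⟶ q₁ ≫ g) (t : X ⟶ Y) (a : Y ⟶ E) :
    precompCell ψ (t ≫ a) = (α_ t a q₀).hom ▷ f ≫ precompCell (precompCell ψ a) t ≫
      (α_ t a q₁).inv ▷ g := by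
  simp [precompCell]

lemma precompCell_conj {b b' : Y ⟶ B} {c c' : Y ⟶ C} (x : b' ⟶ b) (χ : b ≫ f ⟶ c ≫ g)
    (y : c ⟶ c') (t : X ⟶ Y) : precompCell (x ▷ f ≫ χ ≫ y ▷ g) t =
      (t ◁ x) ▷ f ≫ precompCell χ t ≫ (t ◁ y) ▷ g := by
  simp [precompCell]

lemma square_comp {b b' b'' : X ⟶ B} {c c' c'' : X ⟶ C} {χ : b ≫ f ⟶ c ≫ g}
    {χ' : b' ≫ f ⟶ c' ≫ g} {χ'' : b'' ≫ f ⟶ c'' ≫ g} {x : b ⟶ b'} {y : c ⟶ c'} {x' : b' ⟶ b''}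
    {y' : c' ⟶ c''} (h : χ ≫ y ▷ g = x ▷ f ≫ χ') (h' : χ' ≫ y' ▷ g = x' ▷ f ≫ χ'') :
    χ ≫ (y ≫ y') ▷ g = (x ≫ x') ▷ f ≫ χ'' := by
  rw [Bicategory.comp_whiskerRight, Bicategory.comp_whiskerRight, reassoc_of% h, h',
    Category.assoc]

lemma square_inv {b b' : X ⟶ B} {c c' : X ⟶ C} {χ : b ≫ f ⟶ c ≫ g}
    {χ' : b' ≫ f ⟶ c' ≫ g} {x : b ≅ b'} {y : c ≅ c'} (h : χ ≫ y.hom ▷ g = x.hom ▷ f ≫ χ') :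
    χ' ≫ y.inv ▷ g = x.inv ▷ f ≫ χ := by
  rw [← cancel_epi (x.hom ▷ f), ← reassoc_of% h, hom_inv_whiskerRight, Category.comp_id,
    hom_inv_whiskerRight_assoc]

/-- The restriction of a cell `τ : b ⟶ c ≫ ℓ` along a 1-cell. -/
def precompLift {ℓ : C ⟶ B} {b : Y ⟶ B} {c : Y ⟶ C} (τ : b ⟶ c ≫ ℓ) (t : X ⟶ Y) :
    t ≫ b ⟶ (t ≫ c) ≫ ℓ :=
  t ◁ τ ≫ (α_ t c ℓ).inv

/-- The pasted composite of `τ : b ⟶ c ≫ ℓ` with a triangle `lam : ℓ ≫ f ⟶ g`. -/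
def pasteLift {ℓ : C ⟶ B} (lam : ℓ ≫ f ⟶ g) {b : X ⟶ B} {c : X ⟶ C} (τ : b ⟶ c ≫ ℓ) :
    b ≫ f ⟶ c ≫ g :=
  τ ▷ f ≫ (α_ c ℓ f).hom ≫ c ◁ lam

variable {ℓ : C ⟶ B} (lam : ℓ ≫ f ⟶ g)

lemma precompLift_naturality {b : Y ⟶ B} {c : Y ⟶ C} (φ : b ⟶ c ≫ ℓ) {t t' : X ⟶ Y} (τ : t ⟶ t') :
    τ ▷ b ≫ precompLift φ t' = precompLift φ t ≫ (τ ▷ c) ▷ ℓ := by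
  rw [precompLift, precompLift, ← whisker_exchange_assoc, associator_inv_naturality_left,
    Category.assoc]

lemma precompLift_id {b : Y ⟶ B} {c : Y ⟶ C} (φ : b ⟶ c ≫ ℓ) :
    precompLift φ (𝟙 Y) = (λ_ b).hom ≫ φ ≫ (λ_ c).inv ▷ ℓ := by
  simp [precompLift]

lemma precompLift_comp {Z : 𝓑} {b : Y ⟶ B} {c : Y ⟶ C} (φ : b ⟶ c ≫ ℓ) (s : Z ⟶ X) (t : X ⟶ Y) :
    precompLift φ (s ≫ t) = (α_ s t b).hom ≫ precompLift (precompLift φ t) s ≫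
      (α_ s t c).inv ▷ ℓ := by
  simp [precompLift]

lemma pasteLift_comp {b b' : X ⟶ B} {c : X ⟶ C} (x : b' ⟶ b) (τ : b ⟶ c ≫ ℓ) :
    pasteLift lam (x ≫ τ) = x ▷ f ≫ pasteLift lam τ := by
  simp [pasteLift]

lemma pasteLift_whiskerRight {b : X ⟶ B} {c c' : X ⟶ C} (τ : b ⟶ c ≫ ℓ) (y : c ⟶ c') :
    pasteLift lam (τ ≫ y ▷ ℓ) = pasteLift lam τ ≫ y ▷ g := by
  simp [pasteLift, whisker_exchange]

lemma pasteLift_precompLift {b : Y ⟶ B} {c : Y ⟶ C} (τ : b ⟶ c ≫ ℓ) (t : X ⟶ Y) :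
    pasteLift lam (precompLift τ t) = precompCell (pasteLift lam τ) t := by
  simp [pasteLift, precompLift, precompCell]

lemma pasteLift_leftUnitor_inv : pasteLift lam (λ_ ℓ).inv = lam ≫ (λ_ g).inv := by
  simp [pasteLift]

/-- The weak universal property of a comma object of an identity along `ℓ`. -/
structure IsWeakCommaId {p₀ : E ⟶ B} {p₁ : E ⟶ C} (φ : p₀ ⟶ p₁ ≫ ℓ) : Prop where
  exists_hom {X : 𝓑} (b : X ⟶ B) (c : X ⟶ C) (χ : b ⟶ c ≫ ℓ) :
    ∃ (a : X ⟶ E) (i₀ : a ≫ p₀ ≅ b) (i₁ : a ≫ p₁ ≅ c),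
      precompLift φ a ≫ i₁.hom ▷ ℓ = i₀.hom ≫ χ
  exists_cell {X : 𝓑} {a a' : X ⟶ E} (τ₀ : a ≫ p₀ ⟶ a' ≫ p₀) (τ₁ : a ≫ p₁ ⟶ a' ≫ p₁)
    (h : τ₀ ≫ precompLift φ a' = precompLift φ a ≫ τ₁ ▷ ℓ) :
    ∃ τ : a ⟶ a', τ ▷ p₀ = τ₀ ∧ τ ▷ p₁ = τ₁
  isIso {X : 𝓑} {a a' : X ⟶ E} (τ : a ⟶ a') (h₀ : IsIso (τ ▷ p₀)) (h₁ : IsIso (τ ▷ p₁)) : IsIso τ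

lemma precompCell_rightUnitor {p₀ : E ⟶ B} {p₁ : E ⟶ C} (φ : p₀ ≫ 𝟙 B ⟶ p₁ ≫ ℓ) (a : X ⟶ E) :
    precompCell φ a = (ρ_ (a ≫ p₀)).hom ≫ precompLift ((ρ_ p₀).inv ≫ φ) a := by
  simp [precompCell, precompLift]

lemma IsWeakComma.isWeakCommaId {p₀ : E ⟶ B} {p₁ : E ⟶ C} {φ : p₀ ≫ 𝟙 B ⟶ p₁ ≫ ℓ}
    (h : IsWeakComma φ) : IsWeakCommaId ((ρ_ p₀).inv ≫ φ) where
  exists_hom b c χ := by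
    obtain ⟨a, i₀, i₁, e⟩ := h.exists_hom b c ((ρ_ b).hom ≫ χ)
    refine ⟨a, i₀, i₁, ?_⟩
    rw [precompCell_rightUnitor, Category.assoc, rightUnitor_naturality_assoc,
      cancel_epi] at e
    exact e
  exists_cell τ₀ τ₁ e := by
    apply h.exists_cell
    rw [precompCell_rightUnitor, precompCell_rightUnitor, rightUnitor_naturality_assoc, e,
      Category.assoc]
  isIso := h.isIso

section

variable {E' : 𝓑} {p₀ : E' ⟶ B} {p₁ : E' ⟶ C} {φ : p₀ ⟶ p₁ ≫ ℓ}

/-- Restricting the pasted cell along the 1-cell `i` that classifies the identity of `ℓ` recovers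
`lam`, up to the coherence isomorphisms made explicit in `key`. -/
lemma IsWeakCommaId.pasteLift_injective (hφ : IsWeakCommaId φ) {lam lam' : ℓ ≫ f ⟶ g}
    (h : pasteLift lam φ = pasteLift lam' φ) : lam = lam' := by
  obtain ⟨i, k₀, k₁, e⟩ := hφ.exists_hom ℓ (𝟙 C) (λ_ ℓ).inv
  have key : ∀ μ : ℓ ≫ f ⟶ g,
      μ = k₀.inv ▷ f ≫ precompCell (pasteLift μ φ) i ≫ k₁.hom ▷ g ≫ (λ_ g).hom := by
    intro μ
    have := congrArg (pasteLift μ) e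
    rw [pasteLift_whiskerRight, pasteLift_comp, pasteLift_precompLift,
      pasteLift_leftUnitor_inv] at this
    rw [reassoc_of% this]
    simp
  rw [key lam, h, ← key lam']

/-- The preimage of `Ψ` is its restriction along `i`. That it pastes back to `Ψ` is naturality of
`Ψ` along `η`, which plays the role of the unit of an adjunction between `p₁` and `i`. -/
lemma IsWeakCommaId.pasteLift_surjective (hφ : IsWeakCommaId φ) (Ψ : p₀ ≫ f ⟶ p₁ ≫ g) :
    ∃ lam : ℓ ≫ f ⟶ g, pasteLift lam φ = Ψ := by
  obtain ⟨i, k₀, k₁, e⟩ := hφ.exists_hom ℓ (𝟙 C) (λ_ ℓ).inv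
  -- Up to coherence, the components of `η` are `φ` over `B` and the identity over `C`.
  obtain ⟨η, h₀, h₁⟩ := hφ.exists_cell (a := 𝟙 E') (a' := p₁ ≫ i)
    ((λ_ p₀).hom ≫ φ ≫ p₁ ◁ k₀.inv ≫ (α_ p₁ i p₀).inv)
    ((λ_ p₁).hom ≫ (ρ_ p₁).inv ≫ p₁ ◁ k₁.inv ≫ (α_ p₁ i p₁).inv) (by
      have e' : precompLift φ i = k₀.hom ≫ (λ_ ℓ).inv ≫ k₁.inv ▷ ℓ := by
        rw [← reassoc_of% e]
        simp
      rw [precompLift_comp, e', precompLift_id]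
      simp [precompLift])
  refine ⟨k₀.inv ▷ f ≫ precompCell Ψ i ≫ k₁.hom ▷ g ≫ (λ_ g).hom, ?_⟩
  have n := precompCell_naturality Ψ η
  rw [h₀, h₁, precompCell_id, precompCell_comp] at n
  have n' := congrArg (fun t ↦ (λ_ p₀).inv ▷ f ≫ t ≫ (α_ p₁ i p₁).hom ▷ g ≫ (p₁ ◁ k₁.hom) ▷ g ≫
    (ρ_ p₁).hom ▷ g) n
  simpa [pasteLift, precompCell] using n'

end

section

variable {E' : 𝓑} {p₀ : E' ⟶ B} {p₁ : E' ⟶ C} {φ : p₀ ⟶ p₁ ≫ ℓ} {ψ : q₀ ≫ f ⟶ q₁ ≫ g}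
  {k : E' ⟶ E} {i₀ : k ≫ q₀ ≅ p₀} {i₁ : k ≫ q₁ ≅ p₁}

lemma precompCell_comp_square {b : Y ⟶ B} {c : Y ⟶ C} {χ : b ≫ f ⟶ c ≫ g} {a : Y ⟶ E}
    {x : a ≫ q₀ ≅ b} {y : a ≫ q₁ ≅ c} (h : precompCell ψ a ≫ y.hom ▷ g = x.hom ▷ f ≫ χ)
    (t : X ⟶ Y) :
    precompCell ψ (t ≫ a) ≫ (α_ t a q₁ ≪≫ whiskerLeftIso t y).hom ▷ g =
      (α_ t a q₀ ≪≫ whiskerLeftIso t x).hom ▷ f ≫ precompCell χ t := by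
  have h₁ := precompCell_conj (𝟙 _) (precompCell ψ a) y.hom t
  have h₀ := precompCell_conj x.hom χ (𝟙 _) t
  simp only [Bicategory.whiskerLeft_id, Bicategory.id_whiskerRight, Category.comp_id,
    Category.id_comp] at h₀ h₁
  rw [h, h₀] at h₁
  rw [precompCell_comp]
  simp only [Iso.trans_hom, whiskerLeftIso_hom, Bicategory.comp_whiskerRight, Category.assoc,
    inv_hom_whiskerRight_assoc]
  rw [h₁]

lemma precompCell_comp_of_induced {lam : ℓ ≫ f ⟶ g}
    (hk : precompCell ψ k ≫ i₁.hom ▷ g = i₀.hom ▷ f ≫ pasteLift lam φ) (t : X ⟶ E') :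
    precompCell ψ (t ≫ k) ≫ (α_ t k q₁ ≪≫ whiskerLeftIso t i₁).hom ▷ g =
      (α_ t k q₀ ≪≫ whiskerLeftIso t i₀).hom ▷ f ≫ pasteLift lam (precompLift φ t) := by
  rw [pasteLift_precompLift, precompCell_comp_square hk]

lemma whiskerRight_eq_of_conj {p : E' ⟶ B} {i : k ≫ q₀ ≅ p} {t t' : X ⟶ E'} {ζ : t ⟶ t'}
    {σ : t ≫ p ⟶ t' ≫ p} (h : ζ ▷ k ▷ q₀ = (α_ t k q₀ ≪≫ whiskerLeftIso t i).hom ≫ σ ≫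
      (α_ t' k q₀ ≪≫ whiskerLeftIso t' i).inv) : ζ ▷ p = σ := by
  rw [← cancel_epi (α_ t k q₀ ≪≫ whiskerLeftIso t i).hom,
    ← cancel_mono (α_ t' k q₀ ≪≫ whiskerLeftIso t' i).inv, Category.assoc, Category.assoc, ← h]
  simp [← whisker_exchange_assoc]

/-- Postcomposition with an equivalence is an equivalence of hom-categories, hence full. -/
lemma IsEquivalence.exists_whiskerRight_eq (hk : IsEquivalence k) {t t' : X ⟶ E'}
    (σ : t ≫ k ⟶ t' ≫ k) : ∃ ζ : t ⟶ t', ζ ▷ k = σ := by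
  obtain ⟨l, ⟨u⟩, ⟨c⟩⟩ := (isEquivalence_iff k).1 hk
  let e : (X ⟶ E') ≌ (X ⟶ E) := CategoryTheory.Equivalence.mk (postcomp X k) (postcomp X l)
    (NatIso.ofComponents (fun t ↦ (ρ_ t).symm ≪≫ whiskerLeftIso t u ≪≫ (α_ t k l).symm) (by
      intro t t' τ
      change τ ≫ ((ρ_ t').inv ≫ t' ◁ u.hom ≫ (α_ t' k l).inv) =
        ((ρ_ t).inv ≫ t ◁ u.hom ≫ (α_ t k l).inv) ≫ τ ▷ k ▷ l
      rw [Category.assoc, Category.assoc, ← associator_inv_naturality_left,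
        whisker_exchange_assoc, rightUnitor_inv_naturality_assoc]))
    (NatIso.ofComponents (fun t ↦ α_ t l k ≪≫ whiskerLeftIso t c ≪≫ ρ_ t) (by
      intro t t' τ
      change τ ▷ l ▷ k ≫ (α_ t' l k).hom ≫ t' ◁ c.hom ≫ (ρ_ t').hom =
        ((α_ t l k).hom ≫ t ◁ c.hom ≫ (ρ_ t).hom) ≫ τ
      rw [associator_naturality_left_assoc, ← whisker_exchange_assoc, rightUnitor_naturality,
        Category.assoc, Category.assoc]))
  exact e.functor.map_surjective σ

lemma isAbsoluteRightLifting_of_isEquivalence (hψ : IsWeakComma ψ) (hφ : IsWeakCommaId φ)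
    {lam : ℓ ≫ f ⟶ g} (hk : precompCell ψ k ≫ i₁.hom ▷ g = i₀.hom ▷ f ≫ pasteLift lam φ)
    (he : IsEquivalence k) : IsAbsoluteRightLifting lam := by
  rw [isAbsoluteRightLifting_iff]
  intro X c b χ
  apply existsUnique_of_exists_of_unique
  · obtain ⟨a, k₀, k₁, ha⟩ := hψ.exists_hom b c χ
    obtain ⟨l, -, ⟨ζ⟩⟩ := (isEquivalence_iff k).1 he
    -- The 1-cell `a` classifies `χ`. Its image `t` under the inverse of `k` classifies the required
    -- lifting, since `t ≫ k ≅ a`.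
    let t := a ≫ l
    let θ : t ≫ k ≅ a := α_ a l k ≪≫ whiskerLeftIso a ζ ≪≫ ρ_ a
    refine ⟨k₀.inv ≫ θ.inv ▷ q₀ ≫ (α_ t k q₀ ≪≫ whiskerLeftIso t i₀).hom ≫ precompLift φ t ≫
      ((α_ t k q₁ ≪≫ whiskerLeftIso t i₁).inv ≫ θ.hom ▷ q₁ ≫ k₁.hom) ▷ ℓ, ?_⟩
    change pasteLift lam _ = χ
    have h := square_comp (square_inv (precompCell_comp_of_induced hk t))
      (square_comp (precompCell_naturality ψ θ.hom).symm ha)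
    rw [pasteLift_comp, pasteLift_comp, pasteLift_comp, pasteLift_whiskerRight, h]
    simp only [Bicategory.comp_whiskerRight, Category.assoc, hom_inv_whiskerRight_assoc]
    have h₂ : (θ.inv ▷ q₀) ▷ f ≫ (θ.hom ▷ q₀) ▷ f = 𝟙 _ := by
      rw [← Bicategory.comp_whiskerRight, inv_hom_whiskerRight, Bicategory.id_whiskerRight]
    rw [reassoc_of% h₂, inv_hom_whiskerRight_assoc]
  · intro τ τ' hτ hτ'
    obtain ⟨t, j₀, j₁, hj⟩ := hφ.exists_hom b c τ
    obtain ⟨t', j₀', j₁', hj'⟩ := hφ.exists_hom b c τ'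
    have ht := precompCell_comp_of_induced hk t
    have ht' := precompCell_comp_of_induced hk t'
    have hT : pasteLift lam τ = pasteLift lam τ' := hτ.trans hτ'.symm
    have e := congrArg (pasteLift lam) hj
    have e' := congrArg (pasteLift lam) hj'
    rw [pasteLift_whiskerRight, pasteLift_comp] at e e'
    -- The two liftings have equal pastings, so `t ≫ k` and `t' ≫ k` are joined by a 2-cell over
    -- identities. Fullness brings it back to `t ⟶ t'`, and naturality of `φ` along it equates the
    -- liftings.
    obtain ⟨σ, h₀, h₁⟩ := hψ.exists_cell (a := t ≫ k) (a' := t' ≫ k)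
      ((α_ t k q₀ ≪≫ whiskerLeftIso t i₀).hom ≫ (j₀.hom ≫ j₀'.inv) ≫
        (α_ t' k q₀ ≪≫ whiskerLeftIso t' i₀).inv)
      ((α_ t k q₁ ≪≫ whiskerLeftIso t i₁).hom ≫ (j₁.hom ≫ j₁'.inv) ≫
        (α_ t' k q₁ ≪≫ whiskerLeftIso t' i₁).inv)
      (square_comp ht (square_comp (square_comp (e.trans (congrArg (_ ≫ ·) hT)) (square_inv e'))
        (square_inv ht'))).symm
    obtain ⟨ζ, rfl⟩ := he.exists_whiskerRight_eq σ
    have n := precompLift_naturality φ ζ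
    rw [whiskerRight_eq_of_conj h₀, whiskerRight_eq_of_conj h₁, Category.assoc,
      Bicategory.comp_whiskerRight, reassoc_of% hj, cancel_epi] at n
    rw [← cancel_epi j₀'.inv, reassoc_of% n] at hj'
    simpa using hj'

lemma isEquivalence_of_isAbsoluteRightLifting (hψ : IsWeakComma ψ) (hφ : IsWeakCommaId φ)
    {lam : ℓ ≫ f ⟶ g} (hk : precompCell ψ k ≫ i₁.hom ▷ g = i₀.hom ▷ f ≫ pasteLift lam φ)
    (hlam : IsAbsoluteRightLifting lam) : IsEquivalence k := by
  rw [isAbsoluteRightLifting_iff] at hlam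
  -- Absoluteness is applied to the universal cell itself; the 1-cell `l` classifying the resulting
  -- lifting is the candidate inverse.
  obtain ⟨τ, hτ : pasteLift lam τ = ψ, -⟩ := hlam E q₁ q₀ ψ
  obtain ⟨l, j₀, j₁, hl⟩ := hφ.exists_hom q₀ q₁ τ
  have e := congrArg (pasteLift lam) hl
  rw [pasteLift_whiskerRight, pasteLift_comp, hτ] at e
  have hid : ∀ {Z : 𝓑} {b : Z ⟶ B} {c : Z ⟶ C} (χ : b ≫ f ⟶ c ≫ g),
      χ ≫ (λ_ c).inv ▷ g = (λ_ b).inv ▷ f ≫ precompCell χ (𝟙 Z) := by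
    intro Z b c χ
    rw [precompCell_id, inv_hom_whiskerRight_assoc]
  rw [isEquivalence_iff]
  refine ⟨l, ?_, ?_⟩
  · obtain ⟨σ, h₀, h₁⟩ := hφ.exists_cell (a := k ≫ l) (a' := 𝟙 E')
      ((α_ k l p₀ ≪≫ whiskerLeftIso k j₀).hom ≫ i₀.hom ≫ (λ_ p₀).inv)
      ((α_ k l p₁ ≪≫ whiskerLeftIso k j₁).hom ≫ i₁.hom ≫ (λ_ p₁).inv) (by
      -- Compatibility over `B ↓ ℓ` is an equation between liftings, so uniqueness allows it to be
      -- checked after pasting with `lam`.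
      refine (hlam _ _ _ _).unique ?_ rfl
      change pasteLift lam _ = pasteLift lam _
      rw [pasteLift_whiskerRight, pasteLift_comp, pasteLift_precompLift, pasteLift_precompLift]
      rw [pasteLift_precompLift] at e
      exact (square_comp (precompCell_comp_square e k) (square_comp hk (hid _))).symm)
    have : IsIso σ := hφ.isIso σ (by rw [h₀]; infer_instance) (by rw [h₁]; infer_instance)
    exact ⟨(asIso σ).symm⟩
  · obtain ⟨σ, h₀, h₁⟩ := hψ.exists_cell (a := l ≫ k) (a' := 𝟙 E)
      ((α_ l k q₀ ≪≫ whiskerLeftIso l i₀).hom ≫ j₀.hom ≫ (λ_ q₀).inv)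
      ((α_ l k q₁ ≪≫ whiskerLeftIso l i₁).hom ≫ j₁.hom ≫ (λ_ q₁).inv)
      (square_comp (precompCell_comp_of_induced hk l) (square_comp e (hid _))).symm
    have : IsIso σ := hψ.isIso σ (by rw [h₀]; infer_instance) (by rw [h₁]; infer_instance)
    exact ⟨asIso σ⟩

end

end WeakComma

/-! ### Commas of quasi-categories are weak commas in the 2-category. -/

noncomputable section

open MonoidalCategory CartesianMonoidalCategory Simplicial

section

variable {X Y : SSet.{u}} (W : X ⊗ Δ[2] ⟶ Y)

lemma ι₀_δ_two : SSet.ι₀ ≫ X ◁ SSet.stdSimplex.δ 2 ≫ W = SSet.ι₀ ≫ X ◁ SSet.stdSimplex.δ 1 ≫ W := by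
  rw [ι₀_eq, Category.assoc, Category.assoc, whiskerLeft_δ, whiskerLeft_δ, whiskerLeft_δ,
    cylinderMap_comp_assoc, cylinderMap_comp_assoc]
  exact congrArg (_ ≫ cylinderMap X · ≫ W) (by decide)

lemma ι₁_δ_two : SSet.ι₁ ≫ X ◁ SSet.stdSimplex.δ 2 ≫ W = SSet.ι₀ ≫ X ◁ SSet.stdSimplex.δ 0 ≫ W := by
  rw [ι₁_eq, ι₀_eq, Category.assoc, Category.assoc, whiskerLeft_δ, whiskerLeft_δ, whiskerLeft_δ,
    whiskerLeft_δ, cylinderMap_comp_assoc, cylinderMap_comp_assoc]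
  exact congrArg (_ ≫ cylinderMap X · ≫ W) (by decide)

lemma ι₁_δ_zero : SSet.ι₁ ≫ X ◁ SSet.stdSimplex.δ 0 ≫ W = SSet.ι₁ ≫ X ◁ SSet.stdSimplex.δ 1 ≫ W := by
  rw [ι₁_eq, Category.assoc, Category.assoc, whiskerLeft_δ, whiskerLeft_δ, whiskerLeft_δ,
    cylinderMap_comp_assoc, cylinderMap_comp_assoc]
  exact congrArg (_ ≫ cylinderMap X · ≫ W) (by decide)

lemma comp_lift_eq {V W : SSet.{u}} (k : V ⟶ W) (T : W ⟶ X) (S : W ⟶ Y) (H : V ⟶ X ⊗ Y)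
    (hT : k ≫ T = H ≫ fst X Y) (hS : k ≫ S = H ≫ snd X Y) : k ≫ lift T S = H := by
  rw [comp_lift, hT, hS, ← comp_lift, lift_fst_snd, Category.comp_id]

end

namespace QCat₂

open Bicategory

variable {A B C X Y Z : QCat₂.{u}} {f : B ⟶ A} {g : C ⟶ A}

lemma eqToHom_comp_cellOfHomotopy {h h' k k' : X ⟶ Y} (e : h' = h) (e' : k = k')
    (H : X.sSet ⊗ Δ[1] ⟶ Y.sSet) (h₀ : SSet.ι₀ ≫ H = map h) (h₁ : SSet.ι₁ ≫ H = map k) :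
    eqToHom e ≫ cellOfHomotopy H h₀ h₁ ≫ eqToHom e' =
      cellOfHomotopy H (h₀.trans (congrArg map e.symm)) (h₁.trans (congrArg map e')) := by
  subst e e'
  simp

lemma cellOfHomotopy_congr {h k : X ⟶ Y} {H H' : X.sSet ⊗ Δ[1] ⟶ Y.sSet} (e : H = H')
    (h₀ : SSet.ι₀ ≫ H = map h) (h₁ : SSet.ι₁ ≫ H = map k) (h₀' : SSet.ι₀ ≫ H' = map h)
    (h₁' : SSet.ι₁ ≫ H' = map k) : cellOfHomotopy H h₀ h₁ = cellOfHomotopy H' h₀' h₁' := by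
  subst e
  rfl

lemma cellOfHomotopy_id_comp {h k l : X ⟶ Y} (e : k = h) {H K : X.sSet ⊗ Δ[1] ⟶ Y.sSet}
    (hH : H = fst X.sSet Δ[1] ≫ map h) (h₀ : SSet.ι₀ ≫ H = map h) (h₁ : SSet.ι₁ ≫ H = map k)
    (k₀ : SSet.ι₀ ≫ K = map k) (k₁ : SSet.ι₁ ≫ K = map l) :
    cellOfHomotopy H h₀ h₁ ≫ cellOfHomotopy K k₀ k₁ =
      cellOfHomotopy K (k₀.trans (congrArg map e)) k₁ := by
  subst e hH
  exact (congrArg (· ≫ _) (cellOfHomotopy_id k)).trans (Category.id_comp _)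

lemma cellOfHomotopy_comp_id {h k l : X ⟶ Y} (e : k = l) {H K : X.sSet ⊗ Δ[1] ⟶ Y.sSet}
    (hK : K = fst X.sSet Δ[1] ≫ map l) (h₀ : SSet.ι₀ ≫ H = map h) (h₁ : SSet.ι₁ ≫ H = map k)
    (k₀ : SSet.ι₀ ≫ K = map k) (k₁ : SSet.ι₁ ≫ K = map l) :
    cellOfHomotopy H h₀ h₁ ≫ cellOfHomotopy K k₀ k₁ =
      cellOfHomotopy H h₀ (h₁.trans (congrArg map e)) := by
  subst e hK
  exact (congrArg (_ ≫ ·) (cellOfHomotopy_id k)).trans (Category.comp_id _)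

lemma cellOfHomotopy_eq_iff {h k : X ⟶ Y} {H K : X.sSet ⊗ Δ[1] ⟶ Y.sSet}
    (h₀ : SSet.ι₀ ≫ H = map h) (h₁ : SSet.ι₁ ≫ H = map k) (k₀ : SSet.ι₀ ≫ K = map h)
    (k₁ : SSet.ι₁ ≫ K = map k) :
    cellOfHomotopy H h₀ h₁ = cellOfHomotopy K k₀ k₁ ↔
      ∃ S : X.sSet ⊗ Δ[2] ⟶ Y.sSet,
        X.sSet ◁ SSet.stdSimplex.δ 2 ≫ S = H ∧
          X.sSet ◁ SSet.stdSimplex.δ 0 ≫ S = fst X.sSet Δ[1] ≫ map k ∧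
          X.sSet ◁ SSet.stdSimplex.δ 1 ≫ S = K :=
  Iff.trans (Eq.congr_left (cellOfHomotopy_comp_id (l := k) rfl rfl h₀ h₁ rfl rfl).symm)
    (cellOfHomotopy_comp_iff (l := k) h₀ h₁ rfl rfl k₀ k₁)

lemma eq_of_map_eq {h k : X ⟶ Y} (e : map h = map k) : h = k := congrArg (ofMap (X := X) (Y := Y)) e

lemma map_comp (h : X ⟶ Y) (k : Y ⟶ Z) : map (h ≫ k) = map h ≫ map k := rfl

lemma cellOfHomotopy_comp_eq_id_iff {h k : X ⟶ Y} {H K : X.sSet ⊗ Δ[1] ⟶ Y.sSet}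
    (h₀ : SSet.ι₀ ≫ H = map h) (h₁ : SSet.ι₁ ≫ H = map k) (k₀ : SSet.ι₀ ≫ K = map k)
    (k₁ : SSet.ι₁ ≫ K = map h) :
    cellOfHomotopy H h₀ h₁ ≫ cellOfHomotopy K k₀ k₁ = 𝟙 h ↔
      ∃ S : X.sSet ⊗ Δ[2] ⟶ Y.sSet,
        X.sSet ◁ SSet.stdSimplex.δ 2 ≫ S = H ∧ X.sSet ◁ SSet.stdSimplex.δ 0 ≫ S = K ∧
          X.sSet ◁ SSet.stdSimplex.δ 1 ≫ S = fst X.sSet Δ[1] ≫ map h := by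
  rw [← cellOfHomotopy_id]
  exact cellOfHomotopy_comp_iff _ _ _ _ _ _

lemma ι₀_path (a : X ⟶ comma f g) :
    SSet.ι₀ ≫ map a ▷ Δ[1] ≫ commaSSetPath (map f) (map g) = map ((a ≫ commaSrc f g) ≫ f) :=
  congrArg (map a ≫ ·) (ι₀_commaSSetPath (map f) (map g))

lemma ι₁_path (a : X ⟶ comma f g) :
    SSet.ι₁ ≫ map a ▷ Δ[1] ≫ commaSSetPath (map f) (map g) = map ((a ≫ commaTgt f g) ≫ g) :=
  congrArg (map a ≫ ·) (ι₁_commaSSetPath (map f) (map g))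

lemma whiskerRight_commaSrc {a a' : X ⟶ comma f g} {E : X.sSet ⊗ Δ[1] ⟶ (comma f g).sSet}
    (e₀ : SSet.ι₀ ≫ E = map a) (e₁ : SSet.ι₁ ≫ E = map a') :
    cellOfHomotopy E e₀ e₁ ▷ commaSrc f g = cellOfHomotopy (h := a ≫ commaSrc f g)
      (k := a' ≫ commaSrc f g) (E ≫ commaSSetSrc (map f) (map g))
      (congrArg (· ≫ commaSSetSrc (map f) (map g)) e₀)
      (congrArg (· ≫ commaSSetSrc (map f) (map g)) e₁) := rfl

lemma whiskerRight_commaTgt {a a' : X ⟶ comma f g} {E : X.sSet ⊗ Δ[1] ⟶ (comma f g).sSet}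
    (e₀ : SSet.ι₀ ≫ E = map a) (e₁ : SSet.ι₁ ≫ E = map a') :
    cellOfHomotopy E e₀ e₁ ▷ commaTgt f g = cellOfHomotopy (h := a ≫ commaTgt f g)
      (k := a' ≫ commaTgt f g) (E ≫ commaSSetTgt (map f) (map g))
      (congrArg (· ≫ commaSSetTgt (map f) (map g)) e₀)
      (congrArg (· ≫ commaSSetTgt (map f) (map g)) e₁) := rfl

lemma isIso_cellOfHomotopy_congr {h k h' k' : X ⟶ Y} {H H' : X.sSet ⊗ Δ[1] ⟶ Y.sSet}
    {h₀ : SSet.ι₀ ≫ H = map h} {h₁ : SSet.ι₁ ≫ H = map k} {p : Y ⟶ Z}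
    (hi : IsIso (cellOfHomotopy H h₀ h₁ ▷ p)) (e : H ≫ map p = H' ≫ map p)
    (h₀' : SSet.ι₀ ≫ H' = map h') (h₁' : SSet.ι₁ ≫ H' = map k') :
    IsIso (cellOfHomotopy H' h₀' h₁' ▷ p) := by
  have key : ∀ {x y x' y' : X ⟶ Z} {K K' : X.sSet ⊗ Δ[1] ⟶ Z.sSet} (_ : K = K')
      (k₀ : SSet.ι₀ ≫ K = map x) (k₁ : SSet.ι₁ ≫ K = map y) (k₀' : SSet.ι₀ ≫ K' = map x')
      (k₁' : SSet.ι₁ ≫ K' = map y'), IsIso (cellOfHomotopy K k₀ k₁) →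
      IsIso (cellOfHomotopy K' k₀' k₁') := by
    rintro x y x' y' K _ rfl k₀ k₁ k₀' k₁' hK
    obtain rfl : x = x' := eq_of_map_eq (k₀.symm.trans k₀')
    obtain rfl : y = y' := eq_of_map_eq (k₁.symm.trans k₁')
    exact hK
  rw [cellOfHomotopy_whiskerRight] at hi ⊢
  exact key e _ _ _ _ hi

lemma precompCell_commaCell (a : X ⟶ comma f g) :
    precompCell (commaCell f g) a =
      cellOfHomotopy (map a ▷ Δ[1] ≫ commaSSetPath (map f) (map g)) (ι₀_path a) (ι₁_path a) :=
  (Category.id_comp _).trans (Category.comp_id _)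

/-- A homotopy representing `χ` lifts through the strict pullback, so the 1-cell lies over `C × B`
on the nose and not merely up to isomorphism. -/
lemma exists_restrictCell_eq {p : X ⟶ prod C B}
    (χ : (p ≫ prodSnd C B) ≫ f ⟶ (p ≫ prodFst C B) ≫ g) :
    ∃ a : SliceHom p (commaProj f g), restrictCell a = χ := by
  obtain ⟨H, h₀, h₁, rfl⟩ := exists_cellOfHomotopy χ
  obtain ⟨a, a₀, a₁, ha⟩ := exists_commaSSetLift (map f) (map g) (map (p ≫ prodSnd C B))
    (map (p ≫ prodFst C B)) H h₀ h₁
  have w : (ofMap a : X ⟶ comma f g) ≫ commaProj f g = p := by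
    have : a ≫ commaSSetProj (map f) (map g) = map p := by
      apply CartesianMonoidalCategory.hom_ext
      · exact a₁
      · exact a₀
    exact congrArg (ofMap (X := X) (Y := prod C B)) this
  refine ⟨⟨ofMap a, w⟩, ?_⟩
  rw [restrictCell]
  refine (congrArg (fun t ↦ _ ≫ t ≫ _) (whiskerLeft_cellOfHomotopy _ _ _ _)).trans ?_
  refine (eqToHom_comp_cellOfHomotopy _ _ _ _ _).trans ?_
  exact cellOfHomotopy_congr ha _ _ _ _

lemma exists_lift_prod (b : X ⟶ B) (c : X ⟶ C) :
    ∃ p : X ⟶ prod C B, p ≫ prodSnd C B = b ∧ p ≫ prodFst C B = c :=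
  ⟨ofMap (lift (map c) (map b)), rfl, rfl⟩

/-- The 2-simplices witnessing the two equalities of projections pair into one 2-simplex of the
product. -/
lemma prod_cell_ext {h k : X ⟶ prod C B} {η θ : h ⟶ k}
    (h₀ : η ▷ prodSnd C B = θ ▷ prodSnd C B) (h₁ : η ▷ prodFst C B = θ ▷ prodFst C B) : η = θ := by
  obtain ⟨H, a₀, a₁, rfl⟩ := exists_cellOfHomotopy η
  obtain ⟨K, b₀, b₁, rfl⟩ := exists_cellOfHomotopy θ
  obtain ⟨S, s₂, s₀, s₁⟩ := (cellOfHomotopy_eq_iff _ _ _ _).1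
    ((cellOfHomotopy_whiskerRight _ _ _ _).symm.trans (h₀.trans (cellOfHomotopy_whiskerRight _ _ _ _)))
  obtain ⟨T, t₂, t₀, t₁⟩ := (cellOfHomotopy_eq_iff _ _ _ _).1
    ((cellOfHomotopy_whiskerRight _ _ _ _).symm.trans (h₁.trans (cellOfHomotopy_whiskerRight _ _ _ _)))
  rw [cellOfHomotopy_eq_iff]
  exact ⟨lift T S, comp_lift_eq _ _ _ _ t₂ s₂, comp_lift_eq _ _ _ _ t₀ s₀,
    comp_lift_eq _ _ _ _ t₁ s₁⟩

lemma exists_comma_cell {a a' : X ⟶ comma f g} (τ₀ : a ≫ commaSrc f g ⟶ a' ≫ commaSrc f g)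
    (τ₁ : a ≫ commaTgt f g ⟶ a' ≫ commaTgt f g)
    (h : τ₀ ▷ f ≫ precompCell (commaCell f g) a' = precompCell (commaCell f g) a ≫ τ₁ ▷ g) :
    ∃ τ : a ⟶ a', τ ▷ commaSrc f g = τ₀ ∧ τ ▷ commaTgt f g = τ₁ := by
  obtain ⟨T₀, a₀, a₁, rfl⟩ := exists_cellOfHomotopy τ₀
  obtain ⟨T₁, b₀, b₁, rfl⟩ := exists_cellOfHomotopy τ₁
  obtain ⟨D, d₀, d₁, hD⟩ := exists_cellOfHomotopy
    (precompCell (commaCell f g) a ≫ cellOfHomotopy T₁ b₀ b₁ ▷ g)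
  rw [← hD] at h
  rw [precompCell_commaCell, cellOfHomotopy_whiskerRight] at h hD
  obtain ⟨S, s₂, s₀, s₁⟩ := (cellOfHomotopy_comp_iff _ _ _ _ _ _).1 h
  obtain ⟨T, t₂, t₀, t₁⟩ := (cellOfHomotopy_comp_iff _ _ _ _ _ _).1 hD.symm
  -- The homotopy `D` represents the common composite, the diagonal of the square. The lift of `τ`
  -- goes through the vertex `m` it defines: an upper edge from `a`, then a lower edge to `a'`.
  obtain ⟨m, m₀, m₁, hm⟩ := exists_commaSSetLift (map f) (map g) (map (a ≫ commaSrc f g))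
    (map (a' ≫ commaTgt f g)) D d₀ d₁
  obtain ⟨(U : X.sSet ⊗ Δ[1] ⟶ (comma f g).sSet), u₀, u₁, eu₀, eu₁⟩ := exists_isUpperEdge (f := map f) (g := map g) (a := map a) (a' := m)
    m₀.symm T₁ b₀ (b₁.trans m₁.symm) T t₂ t₀ (t₁.trans hm.symm)
  obtain ⟨(L : X.sSet ⊗ Δ[1] ⟶ (comma f g).sSet), l₀, l₁, el₀, el₁⟩ := exists_isLowerEdge (f := map f) (g := map g) (a := m) (a' := map a')
    m₁ T₀ (a₀.trans m₀.symm) a₁ S s₂ s₀ (s₁.trans hm.symm)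
  let m' : X ⟶ comma f g := ofMap m
  refine ⟨cellOfHomotopy (k := m') U u₀ u₁ ≫ cellOfHomotopy (h := m') L l₀ l₁, ?_, ?_⟩
  · rw [Bicategory.comp_whiskerRight]
    refine (congrArg₂ (· ≫ ·) (whiskerRight_commaSrc u₀ u₁) (whiskerRight_commaSrc l₀ l₁)).trans ?_
    refine (cellOfHomotopy_id_comp (eq_of_map_eq m₀) eu₀ _ _ _ _).trans ?_
    exact cellOfHomotopy_congr el₀ _ _ _ _
  · rw [Bicategory.comp_whiskerRight]
    refine (congrArg₂ (· ≫ ·) (whiskerRight_commaTgt u₀ u₁) (whiskerRight_commaTgt l₀ l₁)).trans ?_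
    refine (cellOfHomotopy_comp_id (eq_of_map_eq m₁) el₁ _ _ _ _).trans ?_
    exact cellOfHomotopy_congr eu₁ _ _ _ _

lemma exists_section_simplex {L : X.sSet ⊗ Δ[1] ⟶ (comma f g).sSet}
    (hL : IsLowerEdge (f := map f) (g := map g) L) (R : X.sSet ⊗ Δ[2] ⟶ B.sSet)
    (r₀ : X.sSet ◁ SSet.stdSimplex.δ 0 ≫ R = L ≫ map (commaSrc f g))
    (r₁ : X.sSet ◁ SSet.stdSimplex.δ 1 ≫ R = fst X.sSet Δ[1] ≫ SSet.ι₁ ≫ L ≫ map (commaSrc f g)) :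
    ∃ (W : X.sSet ⊗ Δ[2] ⟶ (comma f g).sSet), X.sSet ◁ SSet.stdSimplex.δ 0 ≫ W = L ∧
      X.sSet ◁ SSet.stdSimplex.δ 1 ≫ W = fst X.sSet Δ[1] ≫ SSet.ι₁ ≫ L ∧
      IsLowerEdge (f := map f) (g := map g) (X.sSet ◁ SSet.stdSimplex.δ 2 ≫ W) := by
  obtain ⟨W, w₀, w₁, w₂, -⟩ := hL.exists_section R r₀ r₁
  exact ⟨W, w₀, w₁, w₂⟩

/-- The inverse of the domain component gives the triangle to be lifted. The resulting one-sided
inverse satisfies the same hypotheses, so the construction can be repeated. -/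
lemma exists_section_of_isLowerEdge {a a' : X ⟶ comma f g}
    {L : X.sSet ⊗ Δ[1] ⟶ (comma f g).sSet} (h₀ : SSet.ι₀ ≫ L = map a) (h₁ : SSet.ι₁ ≫ L = map a')
    (hL : IsLowerEdge (f := map f) (g := map g) L)
    (hi : IsIso (cellOfHomotopy L h₀ h₁ ▷ commaSrc f g)) :
    ∃ (L' : X.sSet ⊗ Δ[1] ⟶ (comma f g).sSet)
      (h₀' : SSet.ι₀ ≫ L' = map a') (h₁' : SSet.ι₁ ≫ L' = map a),
      IsLowerEdge (f := map f) (g := map g) L' ∧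
      IsIso (cellOfHomotopy L' h₀' h₁' ▷ commaSrc f g) ∧
      cellOfHomotopy L' h₀' h₁' ≫ cellOfHomotopy L h₀ h₁ = 𝟙 a' := by
  obtain ⟨T, t₀, t₁, hT⟩ := exists_cellOfHomotopy (inv (cellOfHomotopy L h₀ h₁ ▷ commaSrc f g))
  have hc : cellOfHomotopy T t₀ t₁ ≫ cellOfHomotopy (h := a ≫ commaSrc f g)
      (k := a' ≫ commaSrc f g) (L ≫ map (commaSrc f g)) (congrArg (· ≫ map (commaSrc f g)) h₀)
      (congrArg (· ≫ map (commaSrc f g)) h₁) = 𝟙 (a' ≫ commaSrc f g) := by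
    rw [hT]
    exact IsIso.inv_hom_id (cellOfHomotopy L h₀ h₁ ▷ commaSrc f g)
  obtain ⟨R, -, r₀, r₁⟩ := (cellOfHomotopy_comp_eq_id_iff _ _ _ _).1 hc
  obtain ⟨W, w₀, w₁, w₂⟩ := exists_section_simplex hL R r₀
    (by rw [r₁, map_comp, ← h₁, Category.assoc])
  have e₀ : SSet.ι₀ ≫ X.sSet ◁ SSet.stdSimplex.δ 2 ≫ W = map a' :=
    (ι₀_δ_two W).trans ((congrArg (SSet.ι₀ ≫ ·) w₁).trans
      ((SSet.ι₀_fst_assoc _ _).trans h₁))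
  have e₁ : SSet.ι₁ ≫ X.sSet ◁ SSet.stdSimplex.δ 2 ≫ W = map a :=
    (ι₁_δ_two W).trans ((congrArg (SSet.ι₀ ≫ ·) w₀).trans h₀)
  have ec : cellOfHomotopy _ e₀ e₁ ≫ cellOfHomotopy L h₀ h₁ = 𝟙 a' :=
    (cellOfHomotopy_comp_eq_id_iff _ _ _ _).2 ⟨W, rfl, w₀, w₁.trans (congrArg (fst X.sSet Δ[1] ≫ ·) h₁)⟩
  refine ⟨_, e₀, e₁, w₂, ?_, ec⟩
  have hc' := congrArg (· ▷ commaSrc f g) ec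
  rw [Bicategory.comp_whiskerRight, Bicategory.id_whiskerRight, ← IsIso.eq_comp_inv] at hc'
  rw [hc']
  infer_instance

lemma isIso_of_isLowerEdge {a a' : X ⟶ comma f g} {L : X.sSet ⊗ Δ[1] ⟶ (comma f g).sSet}
    (h₀ : SSet.ι₀ ≫ L = map a) (h₁ : SSet.ι₁ ≫ L = map a')
    (hL : IsLowerEdge (f := map f) (g := map g) L)
    (hi : IsIso (cellOfHomotopy L h₀ h₁ ▷ commaSrc f g)) : IsIso (cellOfHomotopy L h₀ h₁) := by
  obtain ⟨L', h₀', h₁', hL', hi', e⟩ := exists_section_of_isLowerEdge h₀ h₁ hL hi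
  -- The section `L'` has a section of its own, which must then equal `L`; so `L'` is a two-sided
  -- inverse.
  obtain ⟨L'', h₀'', h₁'', -, -, e'⟩ := exists_section_of_isLowerEdge h₀' h₁' hL' hi'
  have h : cellOfHomotopy L'' h₀'' h₁'' = cellOfHomotopy L h₀ h₁ := by
    rw [← Category.comp_id (cellOfHomotopy L'' h₀'' h₁''), ← e, reassoc_of% e']
  exact ⟨_, h ▸ e', e⟩

lemma exists_retraction_simplex {U : X.sSet ⊗ Δ[1] ⟶ (comma f g).sSet}
    (hU : IsUpperEdge (f := map f) (g := map g) U) (R : X.sSet ⊗ Δ[2] ⟶ C.sSet)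
    (r₂ : X.sSet ◁ SSet.stdSimplex.δ 2 ≫ R = U ≫ map (commaTgt f g))
    (r₁ : X.sSet ◁ SSet.stdSimplex.δ 1 ≫ R = fst X.sSet Δ[1] ≫ SSet.ι₀ ≫ U ≫ map (commaTgt f g)) :
    ∃ (W : X.sSet ⊗ Δ[2] ⟶ (comma f g).sSet), X.sSet ◁ SSet.stdSimplex.δ 2 ≫ W = U ∧
      X.sSet ◁ SSet.stdSimplex.δ 1 ≫ W = fst X.sSet Δ[1] ≫ SSet.ι₀ ≫ U ∧
      IsUpperEdge (f := map f) (g := map g) (X.sSet ◁ SSet.stdSimplex.δ 0 ≫ W) := by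
  obtain ⟨W, w₂, w₁, w₀, -⟩ := hU.exists_retraction R r₂ r₁
  exact ⟨W, w₂, w₁, w₀⟩

lemma exists_retraction_of_isUpperEdge {a a' : X ⟶ comma f g}
    {U : X.sSet ⊗ Δ[1] ⟶ (comma f g).sSet} (h₀ : SSet.ι₀ ≫ U = map a) (h₁ : SSet.ι₁ ≫ U = map a')
    (hU : IsUpperEdge (f := map f) (g := map g) U)
    (hi : IsIso (cellOfHomotopy U h₀ h₁ ▷ commaTgt f g)) :
    ∃ (U' : X.sSet ⊗ Δ[1] ⟶ (comma f g).sSet)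
      (h₀' : SSet.ι₀ ≫ U' = map a') (h₁' : SSet.ι₁ ≫ U' = map a),
      IsUpperEdge (f := map f) (g := map g) U' ∧
      IsIso (cellOfHomotopy U' h₀' h₁' ▷ commaTgt f g) ∧
      cellOfHomotopy U h₀ h₁ ≫ cellOfHomotopy U' h₀' h₁' = 𝟙 a := by
  obtain ⟨T, t₀, t₁, hT⟩ := exists_cellOfHomotopy (inv (cellOfHomotopy U h₀ h₁ ▷ commaTgt f g))
  have hc : cellOfHomotopy (h := a ≫ commaTgt f g)
      (k := a' ≫ commaTgt f g) (U ≫ map (commaTgt f g)) (congrArg (· ≫ map (commaTgt f g)) h₀)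
      (congrArg (· ≫ map (commaTgt f g)) h₁) ≫ cellOfHomotopy T t₀ t₁ = 𝟙 (a ≫ commaTgt f g) := by
    rw [hT]
    exact IsIso.hom_inv_id (cellOfHomotopy U h₀ h₁ ▷ commaTgt f g)
  obtain ⟨R, r₂, -, r₁⟩ := (cellOfHomotopy_comp_eq_id_iff _ _ _ _).1 hc
  obtain ⟨W, w₂, w₁, w₀⟩ := exists_retraction_simplex hU R r₂
    (by rw [r₁, map_comp, ← h₀, Category.assoc])
  have e₀ : SSet.ι₀ ≫ X.sSet ◁ SSet.stdSimplex.δ 0 ≫ W = map a' :=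
    (ι₁_δ_two W).symm.trans ((congrArg (SSet.ι₁ ≫ ·) w₂).trans h₁)
  have e₁ : SSet.ι₁ ≫ X.sSet ◁ SSet.stdSimplex.δ 0 ≫ W = map a :=
    (ι₁_δ_zero W).trans ((congrArg (SSet.ι₁ ≫ ·) w₁).trans
      ((SSet.ι₁_fst_assoc _ _).trans h₀))
  have ec : cellOfHomotopy U h₀ h₁ ≫ cellOfHomotopy _ e₀ e₁ = 𝟙 a :=
    (cellOfHomotopy_comp_eq_id_iff _ _ _ _).2 ⟨W, w₂, rfl, w₁.trans (congrArg (fst X.sSet Δ[1] ≫ ·) h₀)⟩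
  refine ⟨_, e₀, e₁, w₀, ?_, ec⟩
  have hc' := congrArg (· ▷ commaTgt f g) ec
  rw [Bicategory.comp_whiskerRight, Bicategory.id_whiskerRight, ← IsIso.eq_inv_comp] at hc'
  rw [hc']
  infer_instance

lemma isIso_of_isUpperEdge {a a' : X ⟶ comma f g} {U : X.sSet ⊗ Δ[1] ⟶ (comma f g).sSet}
    (h₀ : SSet.ι₀ ≫ U = map a) (h₁ : SSet.ι₁ ≫ U = map a')
    (hU : IsUpperEdge (f := map f) (g := map g) U)
    (hi : IsIso (cellOfHomotopy U h₀ h₁ ▷ commaTgt f g)) : IsIso (cellOfHomotopy U h₀ h₁) := by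
  obtain ⟨U', h₀', h₁', hU', hi', e⟩ := exists_retraction_of_isUpperEdge h₀ h₁ hU hi
  obtain ⟨U'', h₀'', h₁'', -, -, e'⟩ := exists_retraction_of_isUpperEdge h₀' h₁' hU' hi'
  have h : cellOfHomotopy U h₀ h₁ = cellOfHomotopy U'' h₀'' h₁'' := by
    rw [← Category.comp_id (cellOfHomotopy U h₀ h₁), ← e', reassoc_of% e]
  exact ⟨_, e, h ▸ e'⟩

lemma exists_factorization_simplex (E : X.sSet ⊗ Δ[1] ⟶ (comma f g).sSet) :
    ∃ W : X.sSet ⊗ Δ[2] ⟶ (comma f g).sSet, X.sSet ◁ SSet.stdSimplex.δ 1 ≫ W = E ∧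
      IsUpperEdge (f := map f) (g := map g) (X.sSet ◁ SSet.stdSimplex.δ 2 ≫ W) ∧
      IsLowerEdge (f := map f) (g := map g) (X.sSet ◁ SSet.stdSimplex.δ 0 ≫ W) ∧
      (X.sSet ◁ SSet.stdSimplex.δ 2 ≫ W) ≫ map (commaTgt f g) = E ≫ map (commaTgt f g) ∧
      (X.sSet ◁ SSet.stdSimplex.δ 0 ≫ W) ≫ map (commaSrc f g) = E ≫ map (commaSrc f g) := by
  obtain ⟨W, w₁, w₂, w₀, w₂', w₀'⟩ := exists_factorization (f := map f) (g := map g) E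
  exact ⟨W, w₁, w₂, w₀, w₂', w₀'⟩

/-- In the upper–lower factorization, the upper edge has the codomain component of `τ` and the lower
edge its domain component, so both factors are invertible. -/
lemma isIso_of_isIso_whiskerRight {a a' : X ⟶ comma f g} (τ : a ⟶ a')
    (h₀ : IsIso (τ ▷ commaSrc f g)) (h₁ : IsIso (τ ▷ commaTgt f g)) : IsIso τ := by
  obtain ⟨E, e₀, e₁, rfl⟩ := exists_cellOfHomotopy τ
  obtain ⟨W, w₁, w₂, w₀, w₂', w₀'⟩ := exists_factorization_simplex E
  let m : X ⟶ comma f g := ofMap (SSet.ι₁ ≫ X.sSet ◁ SSet.stdSimplex.δ 2 ≫ W)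
  have u₀ : SSet.ι₀ ≫ X.sSet ◁ SSet.stdSimplex.δ 2 ≫ W = map a :=
    (ι₀_δ_two W).trans ((congrArg (SSet.ι₀ ≫ ·) w₁).trans e₀)
  have u₁ : SSet.ι₁ ≫ X.sSet ◁ SSet.stdSimplex.δ 2 ≫ W = map m := rfl
  have l₀ : SSet.ι₀ ≫ X.sSet ◁ SSet.stdSimplex.δ 0 ≫ W = map m := (ι₁_δ_two W).symm
  have l₁ : SSet.ι₁ ≫ X.sSet ◁ SSet.stdSimplex.δ 0 ≫ W = map a' :=
    (ι₁_δ_zero W).trans ((congrArg (SSet.ι₁ ≫ ·) w₁).trans e₁)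
  have c : cellOfHomotopy _ u₀ u₁ ≫ cellOfHomotopy _ l₀ l₁ = cellOfHomotopy E e₀ e₁ := by
    rw [cellOfHomotopy_comp_iff]
    exact ⟨W, rfl, rfl, w₁⟩
  have i₁ : IsIso (cellOfHomotopy _ u₀ u₁) := by
    apply isIso_of_isUpperEdge _ _ w₂
    exact isIso_cellOfHomotopy_congr h₁ w₂'.symm _ _
  have i₀ : IsIso (cellOfHomotopy _ l₀ l₁) := by
    apply isIso_of_isLowerEdge _ _ w₀
    exact isIso_cellOfHomotopy_congr h₀ w₀'.symm _ _
  rw [← c]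
  infer_instance

lemma sliceHom_commaSrc {p : X ⟶ prod C B} (a : SliceHom p (commaProj f g)) :
    a.hom ≫ commaSrc f g = p ≫ prodSnd C B :=
  congrArg (· ≫ prodSnd C B) a.w

lemma sliceHom_commaTgt {p : X ⟶ prod C B} (a : SliceHom p (commaProj f g)) :
    a.hom ≫ commaTgt f g = p ≫ prodFst C B :=
  congrArg (· ≫ prodFst C B) a.w

lemma precompCell_commaCell_sliceHom {p : X ⟶ prod C B} (a : SliceHom p (commaProj f g)) :
    precompCell (commaCell f g) a.hom ≫ (eqToIso (sliceHom_commaTgt a)).hom ▷ g =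
      (eqToIso (sliceHom_commaSrc a)).hom ▷ f ≫ restrictCell a := by
  obtain ⟨a, rfl⟩ := a
  have h₁ : (Iso.refl (a ≫ commaTgt f g)).hom ▷ g = 𝟙 _ := Bicategory.id_whiskerRight _ _
  have h₀ : (Iso.refl (a ≫ commaSrc f g)).hom ▷ f = 𝟙 _ := Bicategory.id_whiskerRight _ _
  exact (congrArg (_ ≫ ·) h₁).trans ((Category.comp_id _).trans
    ((congrArg (· ≫ _) h₀).trans (Category.id_comp _)).symm)

lemma isWeakComma_commaCell (f : B ⟶ A) (g : C ⟶ A) : IsWeakComma (commaCell f g) where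
  exists_hom b c χ := by
    obtain ⟨p, rfl, rfl⟩ := exists_lift_prod b c
    obtain ⟨a, rfl⟩ := exists_restrictCell_eq χ
    exact ⟨a.hom, _, _, precompCell_commaCell_sliceHom a⟩
  exists_cell := exists_comma_cell
  isIso := isIso_of_isIso_whiskerRight

end QCat₂

end

/-! ### The two bijections and the main theorem. -/

namespace QCat₂

open Bicategory

variable {A B C X : QCat₂.{u}} {f : B ⟶ A} {g : C ⟶ A}

lemma pasteCell_eq {ℓ : C ⟶ B} (lam : ℓ ≫ f ⟶ g) :
    pasteCell lam = pasteLift lam ((ρ_ (commaSrc (𝟙 B) ℓ)).inv ≫ commaCell (𝟙 B) ℓ) := by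
  rw [pasteCell, pasteLift, comp_whiskerRight, Category.assoc]

lemma pasteCell_bijective (f : B ⟶ A) (g : C ⟶ A) (ℓ : C ⟶ B) :
    Function.Bijective (pasteCell : (ℓ ≫ f ⟶ g) → _) := by
  have h := (isWeakComma_commaCell (𝟙 B) ℓ).isWeakCommaId
  constructor
  · intro lam lam' e
    rw [pasteCell_eq, pasteCell_eq] at e
    exact h.pasteLift_injective e
  · intro Ψ
    obtain ⟨lam, e⟩ := h.pasteLift_surjective Ψ
    exact ⟨lam, (pasteCell_eq lam).trans e⟩

lemma IsInducedBy.isAbsoluteRightLifting_iff {ℓ : C ⟶ B} {lam : ℓ ≫ f ⟶ g}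
    {a : SliceHom (commaProj (𝟙 B) ℓ) (commaProj f g)} (ha : IsInducedBy lam a) :
    IsAbsoluteRightLifting lam ↔ IsEquivalence a.hom := by
  have hφ := (isWeakComma_commaCell (𝟙 B) ℓ).isWeakCommaId
  have hψ := isWeakComma_commaCell f g
  have h : precompCell (commaCell f g) a.hom ≫ (eqToIso (sliceHom_commaTgt a)).hom ▷ g =
      (eqToIso (sliceHom_commaSrc a)).hom ▷ f ≫
        pasteLift lam ((ρ_ (commaSrc (𝟙 B) ℓ)).inv ≫ commaCell (𝟙 B) ℓ) :=
    (precompCell_commaCell_sliceHom a).trans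
      (congrArg (_ ≫ ·) (ha.symm.trans (pasteCell_eq lam)))
  exact ⟨isEquivalence_of_isAbsoluteRightLifting hψ hφ h,
    isAbsoluteRightLifting_of_isEquivalence hψ hφ h⟩

/-- For a 2-cell given by a homotopy, both sides are the class of the same composite map. -/
lemma whiskerRight_commaProj_prodSnd {h k : X ⟶ comma f g} (σ : h ⟶ k) :
    (σ ▷ commaProj f g) ▷ prodSnd C B = σ ▷ commaSrc f g := by
  obtain ⟨H, h₀, h₁, rfl⟩ := exists_cellOfHomotopy σ
  rfl

lemma whiskerRight_commaProj_prodFst {h k : X ⟶ comma f g} (σ : h ⟶ k) :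
    (σ ▷ commaProj f g) ▷ prodFst C B = σ ▷ commaTgt f g := by
  obtain ⟨H, h₀, h₁, rfl⟩ := exists_cellOfHomotopy σ
  rfl

lemma eqToHom_whiskerRight_eq {Y Z : QCat₂.{u}} {h k p : X ⟶ Y} (e : h = p) (e' : k = p)
    (q : Y ⟶ Z) : eqToHom (e.trans e'.symm) ▷ q =
      (eqToIso (congrArg (· ≫ q) e)).hom ≫ (eqToIso (congrArg (· ≫ q) e')).inv := by
  subst e e'
  simp

/-- Naturality of the comma cone along a 2-cell over `C × B`, whose components are identities;
invertibility plays no role. -/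
lemma restrictCell_eq_of_sliceCell {p : X ⟶ prod C B} {a b : SliceHom p (commaProj f g)}
    (σ : a ⟶ b) : restrictCell a = restrictCell b := by
  have e₀ : σ.cell ▷ commaSrc f g = (eqToIso (sliceHom_commaSrc a)).hom ≫
      (eqToIso (sliceHom_commaSrc b)).inv := by
    refine (whiskerRight_commaProj_prodSnd σ.cell).symm.trans ?_
    refine (congrArg (· ▷ prodSnd C B) σ.w).trans ?_
    exact eqToHom_whiskerRight_eq a.w b.w _
  have e₁ : σ.cell ▷ commaTgt f g = (eqToIso (sliceHom_commaTgt a)).hom ≫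
      (eqToIso (sliceHom_commaTgt b)).inv := by
    refine (whiskerRight_commaProj_prodFst σ.cell).symm.trans ?_
    refine (congrArg (· ▷ prodFst C B) σ.w).trans ?_
    exact eqToHom_whiskerRight_eq a.w b.w _
  have n := precompCell_naturality (commaCell f g) σ.cell
  rw [e₀, e₁] at n
  have := square_comp (square_inv (precompCell_commaCell_sliceHom a))
    (square_comp n.symm (precompCell_commaCell_sliceHom b))
  simpa using this

/-- Equal cells make the pair of identity components compatible. Induction lifts this pair,
conservativity makes the lift invertible, and `prod_cell_ext` puts it over `C × B`. -/
lemma nonempty_iso_of_restrictCell_eq {p : X ⟶ prod C B} {a b : SliceHom p (commaProj f g)}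
    (h : restrictCell a = restrictCell b) : Nonempty (a ≅ b) := by
  have hψ := isWeakComma_commaCell f g
  have hb := precompCell_commaCell_sliceHom b
  rw [← h] at hb
  obtain ⟨σ, h₀, h₁⟩ := hψ.exists_cell _ _
    (square_comp (precompCell_commaCell_sliceHom a) (square_inv hb)).symm
  have : IsIso σ := hψ.isIso σ (by rw [h₀]; infer_instance) (by rw [h₁]; infer_instance)
  have e : σ ▷ commaProj f g = eqToHom (a.w.trans b.w.symm) := by
    apply prod_cell_ext
    · refine (whiskerRight_commaProj_prodSnd σ).trans (h₀.trans ?_)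
      exact (eqToHom_whiskerRight_eq a.w b.w _).symm
    · refine (whiskerRight_commaProj_prodFst σ).trans (h₁.trans ?_)
      exact (eqToHom_whiskerRight_eq a.w b.w _).symm
  refine ⟨⟨⟨σ, e⟩, ⟨inv σ, ?_⟩, ?_, ?_⟩⟩
  · change inv σ ▷ commaProj f g = eqToHom (b.w.trans a.w.symm)
    rw [← cancel_epi (σ ▷ commaProj f g), ← comp_whiskerRight, IsIso.hom_inv_id, e,
      id_whiskerRight, eqToHom_trans, eqToHom_refl]
  · exact SliceCell.ext (IsIso.hom_inv_id σ)
  · exact SliceCell.ext (IsIso.inv_hom_id σ)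

/-- Isomorphism classes of 1-cells over `C × B` into `f ↓ g` are the 2-cells they classify. -/
noncomputable def sliceHomClassEquiv (p : X ⟶ prod C B) (f : B ⟶ A) (g : C ⟶ A) :
    SliceHomClass p (commaProj f g) ≃ ((p ≫ prodSnd C B) ≫ f ⟶ (p ≫ prodFst C B) ≫ g) :=
  Equiv.ofBijective (Quotient.lift restrictCell fun _ _ ⟨e⟩ ↦ restrictCell_eq_of_sliceCell e.hom)
    ⟨by
      rintro ⟨a⟩ ⟨b⟩ h
      exact Quotient.sound (nonempty_iso_of_restrictCell_eq h), fun χ ↦ by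
      obtain ⟨a, ha⟩ := exists_restrictCell_eq χ
      exact ⟨a.isoClass, ha⟩⟩

end QCat₂

end CommaQCat

open CategoryTheory CommaQCat CommaQCat.QCat₂ in
theorem mainTheorem2 {A B C : QCat₂.{u}} (f : B ⟶ A) (g : C ⟶ A) (ℓ : C ⟶ B) :
    (∀ lam : ℓ ≫ f ⟶ g,
      (∃ w : SliceHom (commaProj (𝟙 B) ℓ) (commaProj f g), IsInducedBy lam w) ∧
      ∀ w : SliceHom (commaProj (𝟙 B) ℓ) (commaProj f g), IsInducedBy lam w →
        (IsAbsoluteRightLifting lam ↔ IsEquivalence w.hom)) ∧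
    ∃ Φ : (ℓ ≫ f ⟶ g) ≃ SliceHomClass (commaProj (𝟙 B) ℓ) (commaProj f g),
      ∀ (lam : ℓ ≫ f ⟶ g) (w : SliceHom (commaProj (𝟙 B) ℓ) (commaProj f g)),
        (Φ lam = w.isoClass ↔ IsInducedBy lam w) ∧
        (Φ lam = w.isoClass → (IsAbsoluteRightLifting lam ↔ IsEquivalence w.hom)) := by
  have key : ∀ (lam : ℓ ≫ f ⟶ g) (w : SliceHom (commaProj (𝟙 B) ℓ) (commaProj f g)),
      ((Equiv.ofBijective pasteCell (pasteCell_bijective f g ℓ)).trans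
        (sliceHomClassEquiv (commaProj (𝟙 B) ℓ) f g).symm) lam = w.isoClass ↔ IsInducedBy lam w :=
    fun lam w ↦ (sliceHomClassEquiv (commaProj (𝟙 B) ℓ) f g).symm_apply_eq (x := pasteCell lam)
  refine ⟨fun lam ↦ ⟨?_, fun w hw ↦ hw.isAbsoluteRightLifting_iff⟩, _,
    fun lam w ↦ ⟨key lam w, fun h ↦ ((key lam w).1 h).isAbsoluteRightLifting_iff⟩⟩
  obtain ⟨w, hw⟩ := exists_restrictCell_eq (p := commaProj (𝟙 B) ℓ) (pasteCell lam)
  exact ⟨w, hw.symm⟩
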